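/- Let $(\Omega,\mathcal F,\mathbb P)$ be a probability space with a filtration $\{\mathcal F_t\}_{t\ge 0}$, and let $\mathsf H$ be a real Hilbert space, with inner product $(\cdot,\cdot)_{\mathsf H}$ and norm $|\cdot|_{\mathsf H}$, of measurable functions $\mathbb R_+\to\mathbb R$ (possibly identified when they agree almost everywhere for a fixed measure on $\mathbb R_+$). Let $U$ be a real-valued Lévy process with respect to $\{\mathcal F_t\}$ with zero mean and finite variance, and let $g\in\mathsf H$ and $h(t)=h(t,\cdot)\in\mathsf H$ for $t\ge 0$ be deterministic. Suppose that the shifts $\mathcal S(t)f:=f(t+\cdot)$, $t\ge 0$, are bounded linear operators on $\mathsf H$, that $s\mapsto g(s+\cdot)\in\mathsf H$ is (strongly) measurable, and that $\int_0^t|g(s+\cdot)|_{\mathsf H}^2\,ds<\infty$ for every $t\ge 0$. Then $$X(t)=h(t)+\int_0^t g(t+\cdot-s)\,dU(s),\qquad t\ge 0,$$ is a well-defined $\mathsf H$-valued stochastic process. That is, for every $t$ the $\mathsf H$-valued stochastic integral, understood as the $L^2(\mathbb P;\mathsf H)$-limit of the elementary integrals $\sum_i (U(b_i)-U(a_i))v_i$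 of step functions $\sum_i 1_{(a_i,b_i]}v_i$ converging to $s\mapsto g(t-s+\cdot)$ in $L^2([0,t];\mathsf H)$, exists and is unique up to almost sure equality, and $X$ has an adapted version. For every $x\ge 0$ at which the evaluation $f\mapsto f(x)$ is well defined and continuous on $\mathsf H$, and every $t\ge0$, one has $X(t)(x)=h(t,x)+\int_0^t g(t+x-s)\,dU(s)$ almost surely. Moreover, let $\psi_U$ be the cumulant of $U(1)$, where the cumulant of a random variable $Z$ with values in a real Hilbert space is the distinguished logarithm $\eta\mapsto\log\mathbb E[e^{\mathrm i(\eta,Z)}]$ of its characteristic function, i.e. the continuous function vanishing at $0$ whose exponential is the characteristic function. Then $\psi_U$ exists and, for every $t\ge 0$ and $\eta\in\mathsf H$, the function $s\mapsto\psi_U\big((\eta,g(s+\cdot))_{\mathsf H}\big)$ is integrable on $[0,t]$ and $$\log\mathbb E\left[\exp\left(\mathrm i(\eta,X(t))_{\mathsf H}\right)\right]=\mathrm i(\eta,h(t))_{\mathsf H}+\int_0^t\psi_U\left((\eta,g(s+\cdot))_{\mathsf H}\right)ds .$$ -/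

import Mathlib

open MeasureTheory ProbabilityTheory Filter Topology
open scoped NNReal ENNReal

noncomputable section

/-- Lebesgue measure on `ℝ₊`. -/
def lebesgue : Measure ℝ≥0 := Measure.comap ((↑) : ℝ≥0 → ℝ) volume

/-- A Hilbert space `H` of real-valued measurable functions on `ℝ₊`. `carrier` is the vector space
of functions, `toH` sends a function to the element of `H` that it represents, every element of `H`
is represented by a function, and two functions represent the same element iff they agree
`ν`-almost everywhere. With the counting measure for `ν` the elements of `H` are genuine functions
(spaces such as the Filipovic space), with Lebesgue measure they are classes of functions
(spaces such as `L²`). -/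
structure HilbertFunctionSpace (H : Type*) [NormedAddCommGroup H] [InnerProductSpace ℝ H] where
  carrier : Submodule ℝ (ℝ≥0 → ℝ)
  measurable_of_mem : ∀ f ∈ carrier, Measurable f
  ν : Measure ℝ≥0
  toH : carrier →ₗ[ℝ] H
  surjective_toH : Function.Surjective toH
  toH_eq_zero_iff : ∀ f : carrier, toH f = 0 ↔ (f : ℝ≥0 → ℝ) =ᵐ[ν] 0

namespace HilbertFunctionSpace

variable {H : Type*} [NormedAddCommGroup H] [InnerProductSpace ℝ H]

/-- `S` is the shift semigroup `S(t) f = f(t + ·)`, and all the `S(t)` are bounded operators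
on `H`. -/
def IsBoundedShift (V : HilbertFunctionSpace H) (S : ℝ≥0 → H →L[ℝ] H) : Prop :=
  ∀ (t : ℝ≥0) (f : V.carrier), ∃ hf : (fun x ↦ (f : ℝ≥0 → ℝ) (t + x)) ∈ V.carrier,
    S t (V.toH f) = V.toH ⟨fun x ↦ (f : ℝ≥0 → ℝ) (t + x), hf⟩

/-- `δ` is the evaluation at the point `x` (in particular this evaluation is well defined
and continuous on `H`). -/
def IsEvaluation (V : HilbertFunctionSpace H) (x : ℝ≥0) (δ : H →L[ℝ] ℝ) : Prop :=
  ∀ f : V.carrier, δ (V.toH f) = (f : ℝ≥0 → ℝ) x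

end HilbertFunctionSpace

/-- `U` is a real-valued Lévy process for the filtration `𝓕`: it is adapted, starts at `0`, has
stationary increments which are independent of the past, and is continuous in probability. -/
structure IsLevyProcess {Ω : Type*} {mΩ : MeasurableSpace Ω} (𝓕 : Filtration ℝ≥0 mΩ)
    (P : Measure Ω) (U : ℝ≥0 → Ω → ℝ) : Prop where
  adapted : ∀ t, Measurable[𝓕 t] (U t)
  zero : ∀ᵐ ω ∂P, U 0 ω = 0
  indep_increments : ∀ s t, s ≤ t →
    Indep (MeasurableSpace.comap (fun ω ↦ U t ω - U s ω) inferInstance) (𝓕 s) P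
  stationary_increments : ∀ s t, IdentDistrib (fun ω ↦ U (s + t) ω - U s ω) (U t) P P
  stoch_continuous : ∀ s, TendstoInMeasure P U (𝓝 s) (U s)

/-- An `E`-valued step function `∑ᵢ 1_{(aᵢ, bᵢ]} vᵢ` on `[0, t]`. -/
structure StepFunction (E : Type*) (t : ℝ≥0) where
  n : ℕ
  a : Fin n → ℝ≥0
  b : Fin n → ℝ≥0
  v : Fin n → E
  a_le_b : ∀ i, a i ≤ b i
  b_le : ∀ i, b i ≤ t

namespace StepFunction

variable {Ω E : Type*} [NormedAddCommGroup E] [NormedSpace ℝ E] {t : ℝ≥0}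

/-- The values of the step function. -/
def eval (p : StepFunction E t) (s : ℝ≥0) : E :=
  ∑ i, (Set.Ioc (p.a i) (p.b i)).indicator (fun _ ↦ p.v i) s

/-- The elementary integral `∑ᵢ (U(bᵢ) - U(aᵢ)) vᵢ` of the step function. -/
def integral (p : StepFunction E t) (U : ℝ≥0 → Ω → ℝ) (ω : Ω) : E :=
  ∑ i, (U (p.b i) ω - U (p.a i) ω) • p.v i

end StepFunction

/-- `Y` is (a version of) the stochastic integral `∫₀ᵗ f(s) dU(s)` of the deterministic `E`-valued
integrand `f`: there are step functions that converge to `f` in `L²([0, t]; E)` and whose elementary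
integrals converge to `Y` in `L²(P; E)`. -/
def IsStochasticIntegral {Ω E : Type*} {mΩ : MeasurableSpace Ω} [NormedAddCommGroup E]
    [NormedSpace ℝ E] (P : Measure Ω) (U : ℝ≥0 → Ω → ℝ) (t : ℝ≥0) (f : ℝ≥0 → E) (Y : Ω → E) :
    Prop :=
  MemLp Y 2 P ∧ ∃ p : ℕ → StepFunction E t,
    Tendsto (fun n ↦ eLpNorm (fun s ↦ f s - (p n).eval s) 2 (lebesgue.restrict (Set.Icc 0 t)))
      atTop (𝓝 0) ∧
    Tendsto (fun n ↦ eLpNorm (fun ω ↦ Y ω - (p n).integral U ω) 2 P) atTop (𝓝 0)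

/-- `Ψ` is the cumulant `log E[exp(i⟨η, Z⟩)]` of the random variable `Z`, where `log` is the
distinguished logarithm: `Ψ` is the continuous function that vanishes at `0` and whose exponential
is the characteristic function of `Z`. -/
def IsCumulant {Ω E : Type*} {mΩ : MeasurableSpace Ω} [NormedAddCommGroup E]
    [InnerProductSpace ℝ E] (P : Measure Ω) (Z : Ω → E) (Ψ : E → ℂ) : Prop :=
  Continuous Ψ ∧ Ψ 0 = 0 ∧
    ∀ η : E, Complex.exp (Ψ η) = ∫ ω, Complex.exp (Complex.I * (inner ℝ η (Z ω) : ℂ)) ∂P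

/-- `X` is (a version of) the process `X(t) = h(t) + ∫₀ᵗ g(t + · - s) dU(s)`, where
`g(t + · - s) = S(t - s) g`, as an `H`-valued stochastic integral. -/
def IsFactorProcess {Ω H : Type*} {mΩ : MeasurableSpace Ω} [NormedAddCommGroup H]
    [InnerProductSpace ℝ H] (P : Measure Ω) (U : ℝ≥0 → Ω → ℝ) (S : ℝ≥0 → H →L[ℝ] H)
    (h : ℝ≥0 → H) (g : H) (X : ℝ≥0 → Ω → H) : Prop :=
  ∀ t, IsStochasticIntegral P U t (fun s ↦ S (t - s) g) (fun ω ↦ X t ω - h t)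

end

/-! Write `σ²` for the second moment of `U 1`. The second moment of `U t` is additive in `t` and
nonnegative, hence equal to `t * σ²`, and independence of increments makes the covariance `σ² * min
s t`. Up to the factor `σ²` this is the Gram kernel of the indicators of `(0, s]` in `L²`, so
elementary integrals satisfy the Itô isometry `eLpNorm_integral_sub_integral`. With density of step
functions and completeness it yields existence (`exists_stochasticIntegral`) and uniqueness
(`ae_eq_of_isStochasticIntegral`). Bounded operators pass through the integral
(`IsStochasticIntegral.map`); applied to an evaluation this is the pointwise formula.

For the cumulant no branch of the logarithm has to be chosen: for fixed `u` the characteristic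
function of `U t` is a continuous multiplicative semigroup in `t`, hence `exp (t * ψ u)`
(`exists_exponent`). Zero mean and finite variance give `‖ψ u - ψ v‖ ≤ 3 * σ² * (|u - v| * (|u| +
|v|))`. This quadratic control makes `∫ ψ⟨η, f⟩` finite for `f` in `L²`, continuous in `f` and
continuous in `η`. For step functions on a partition the formula is a product over independent
increments; both sides pass to the `L²` limit. The reflection `s ↦ t - s` turns `S (t - s) g` into
`S s g`, and continuity in `η` with value `0` at `0` identifies the exponent as the distinguished
logarithm. -/

/-! ### Lebesgue measure on the half-line. -/

theorem measurableEmbedding_nnreal_coe : MeasurableEmbedding ((↑) : ℝ≥0 → ℝ) :=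
  MeasurableEmbedding.subtype_coe measurableSet_Ici

theorem lebesgue_apply (s : Set ℝ≥0) : lebesgue s = volume (((↑) : ℝ≥0 → ℝ) '' s) :=
  measurableEmbedding_nnreal_coe.comap_apply _ _

theorem lebesgue_Icc (a b : ℝ≥0) : lebesgue (Set.Icc a b) = ENNReal.ofReal (b - a) := by
  rw [lebesgue_apply, NNReal.image_coe_Icc, Real.volume_Icc]

theorem lebesgue_Ioc (a b : ℝ≥0) : lebesgue (Set.Ioc a b) = ENNReal.ofReal (b - a) := by
  rw [lebesgue_apply, NNReal.image_coe_Ioc, Real.volume_Ioc]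

theorem lebesgue_singleton (a : ℝ≥0) : lebesgue {a} = 0 := by
  simp [lebesgue_apply]

instance isFiniteMeasure_lebesgue_restrict_Icc (a b : ℝ≥0) :
    IsFiniteMeasure (lebesgue.restrict (Set.Icc a b)) :=
  ⟨by simp [lebesgue_Icc]⟩

theorem map_coe_lebesgue_restrict_Icc (t : ℝ≥0) :
    (lebesgue.restrict (Set.Icc 0 t)).map ((↑) : ℝ≥0 → ℝ) =
      volume.restrict (Set.Icc (0 : ℝ) t) := by
  have h : Set.Icc (0 : ℝ≥0) t = ((↑) : ℝ≥0 → ℝ) ⁻¹' Set.Icc (0 : ℝ) t := by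
    ext x; simp
  rw [h, ← measurableEmbedding_nnreal_coe.restrict_map, lebesgue,
    measurableEmbedding_nnreal_coe.map_comap,
    Measure.restrict_restrict_of_subset]
  intro x hx
  exact ⟨⟨x, hx.1⟩, rfl⟩

/-- The reflection `s ↦ t - s` preserves Lebesgue measure on `[0, t]`. -/
theorem measurePreserving_tsub_lebesgue (t : ℝ≥0) :
    MeasurePreserving (fun s ↦ t - s) (lebesgue.restrict (Set.Icc 0 t))
      (lebesgue.restrict (Set.Icc 0 t)) := by
  have hm : Measurable (fun s : ℝ≥0 ↦ t - s) := measurable_const.sub measurable_id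
  refine ⟨hm, ?_⟩
  -- Pushing forward along a measurable embedding loses nothing, so the measures can be compared on
  -- `ℝ`, where reflection is known to preserve volume.
  have hinj : Function.Injective (Measure.map ((↑) : ℝ≥0 → ℝ)) := fun μ ν h ↦ by
    rw [← measurableEmbedding_nnreal_coe.comap_map μ, h,
      measurableEmbedding_nnreal_coe.comap_map]
  apply hinj
  rw [Measure.map_map measurable_coe_nnreal_real hm]
  have h1 : ((↑) : ℝ≥0 → ℝ) ∘ (fun s ↦ t - s) =ᵐ[lebesgue.restrict (Set.Icc 0 t)]
      (fun x : ℝ ↦ (t : ℝ) - x) ∘ ((↑) : ℝ≥0 → ℝ) := by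
    filter_upwards [ae_restrict_mem measurableSet_Icc] with s hs
    simp [NNReal.coe_sub hs.2]
  rw [Measure.map_congr h1, ← Measure.map_map (by fun_prop) measurable_coe_nnreal_real,
    map_coe_lebesgue_restrict_Icc]
  have h2 := (Measure.measurePreserving_sub_left (volume : Measure ℝ) (t : ℝ)).restrict_preimage
    (measurableSet_Icc (a := (0 : ℝ)) (b := (t : ℝ)))
  have h3 : (fun x : ℝ ↦ (t : ℝ) - x) ⁻¹' Set.Icc (0 : ℝ) t = Set.Icc (0 : ℝ) t := by
    ext x; simp [and_comm]
  rw [h3] at h2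
  exact h2.map_eq

/-- `∫₀ᵗ 1_{(0, a]} 1_{(0, b]} = min a b`. -/
theorem integral_indicator_Ioc_mul_indicator_Ioc {t a b : ℝ≥0} (ha : a ≤ t) :
    ∫ s in Set.Icc 0 t, (Set.Ioc 0 a).indicator (fun _ ↦ (1 : ℝ)) s *
      (Set.Ioc 0 b).indicator (fun _ ↦ (1 : ℝ)) s ∂lebesgue = min a b := by
  have h : (fun s ↦ (Set.Ioc 0 a).indicator (fun _ ↦ (1 : ℝ)) s *
      (Set.Ioc 0 b).indicator (fun _ ↦ (1 : ℝ)) s) =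
      (Set.Ioc 0 (min a b)).indicator (fun _ ↦ (1 : ℝ)) := by
    ext s
    rw [← Set.inter_indicator_mul, Set.Ioc_inter_Ioc]
    simp
  rw [h, integral_indicator measurableSet_Ioc, Measure.restrict_restrict measurableSet_Ioc,
    Set.inter_eq_left.2]
  · rcases le_total a b with h | h <;> simp [measureReal_def, lebesgue_Ioc, h]
  · intro s hs
    exact ⟨zero_le, hs.2.trans ((min_le_left _ _).trans ha)⟩

theorem integrable_indicator_Ioc {E : Type*} [NormedAddCommGroup E] (t a b : ℝ≥0) (v : E) :
    Integrable ((Set.Ioc a b).indicator (fun _ ↦ v)) (lebesgue.restrict (Set.Icc 0 t)) :=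
  (integrable_const v).indicator measurableSet_Ioc

/-! ### Exponential semigroups, Taylor bounds and additive functions. -/

/-- A continuous one-parameter semigroup of complex numbers is an exponential. -/
theorem exists_eq_exp_of_continuous_semigroup {f : ℝ≥0 → ℂ} (hf : Continuous f) (h0 : f 0 = 1)
    (hadd : ∀ s t, f (s + t) = f s * f t) : ∃ z : ℂ, ∀ t : ℝ≥0, f t = Complex.exp (t * z) := by
  set F : ℝ → ℂ := fun t ↦ f t.toNNReal with hF
  have hFc : Continuous F := hf.comp continuous_real_toNNReal
  have hFi : ∀ a b, IntervalIntegrable F volume a b := fun a b ↦ hFc.intervalIntegrable a b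
  have hFadd : ∀ {s t : ℝ}, 0 ≤ s → 0 ≤ t → F (s + t) = F s * F t := fun hs ht ↦ by
    simp [hF, Real.toNNReal_add hs ht, hadd]
  have hFd : ∀ t, HasDerivAt (fun u ↦ ∫ x in (0 : ℝ)..u, F x) (F t) t := fun t ↦
    intervalIntegral.integral_hasDerivAt_right (hFi _ _)
      (hFc.stronglyMeasurableAtFilter _ _) hFc.continuousAt
  -- If all these integrals vanished, the right derivative at `0` would be `0`, but it is `F 0 = 1`.
  obtain ⟨a, ha, hA⟩ : ∃ a : ℝ, 0 < a ∧ ∫ x in (0 : ℝ)..a, F x ≠ 0 := by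
    by_contra! hcon
    have h1 : HasDerivWithinAt (fun u ↦ ∫ x in (0 : ℝ)..u, F x) (F 0) (Set.Ici 0) 0 :=
      (hFd 0).hasDerivWithinAt
    have h2 : HasDerivWithinAt (fun u ↦ ∫ x in (0 : ℝ)..u, F x) 0 (Set.Ici 0) 0 := by
      refine (hasDerivWithinAt_const (0 : ℝ) (Set.Ici 0) (0 : ℂ)).congr (fun x hx ↦ ?_) (by simp)
      rcases (Set.mem_Ici.1 hx).eq_or_lt with h | h
      · simp [← h]
      · exact hcon x h
    have h3 := (uniqueDiffWithinAt_Ici (0 : ℝ)).eq_deriv _ h1 h2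
    simp [hF, h0] at h3
  set A := ∫ x in (0 : ℝ)..a, F x
  -- The semigroup law writes `F t` as a constant times the integral of `F` over `[t, t + a]`, so
  -- continuity of `F` upgrades to differentiability. The law needs nonnegative times, hence the
  -- one-sided derivatives below.
  have hint : ∀ t : ℝ, 0 ≤ t → F t * A = (∫ x in (0 : ℝ)..(t + a), F x) - ∫ x in (0 : ℝ)..t, F x := by
    intro t ht
    rw [intervalIntegral.integral_interval_sub_left (hFi _ _) (hFi _ _),
      ← intervalIntegral.integral_const_mul]
    have : ∫ x in t..(t + a), F x = ∫ x in (0 : ℝ)..a, F (t + x) := by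
      simp
    rw [this]
    refine intervalIntegral.integral_congr fun x hx ↦ ?_
    rw [Set.uIcc_of_le ha.le] at hx
    exact (hFadd ht hx.1).symm
  set z := A⁻¹ * (F a - 1) with hz
  have hder : ∀ t : ℝ, 0 ≤ t → HasDerivWithinAt F (F t * z) (Set.Ici t) t := by
    intro t ht
    have h1 : HasDerivAt (fun t : ℝ ↦
        A⁻¹ * ((∫ x in (0 : ℝ)..(t + a), F x) - ∫ x in (0 : ℝ)..t, F x))
        (A⁻¹ * (F (t + a) - F t)) t :=
      (((hFd (t + a)).comp_add_const t a).sub (hFd t)).const_mul _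
    have h2 : A⁻¹ * (F (t + a) - F t) = F t * z := by
      rw [hFadd ht ha.le, hz]; ring
    rw [h2] at h1
    refine h1.hasDerivWithinAt.congr (fun x hx ↦ ?_) ?_
    · rw [← hint x (ht.trans hx)]; field_simp
    · rw [← hint t ht]; field_simp
  refine ⟨z, fun t ↦ ?_⟩
  have hE : ∀ x : ℝ, HasDerivAt (fun x : ℝ ↦ Complex.exp (-(x * z)))
      (Complex.exp (-(x * z)) * -z) x := fun x ↦ by
    have := (((hasDerivAt_id x).ofReal_comp.mul_const z).neg).cexp
    simpa using this
  have hcst := constant_of_has_deriv_right_zero (a := 0) (b := (t : ℝ))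
    (f := fun x : ℝ ↦ F x * Complex.exp (-(x * z)))
    (hFc.mul (by fun_prop)).continuousOn
    (fun x hx ↦ by
      have := (hder x hx.1).mul (hE x).hasDerivWithinAt
      convert! this using 1
      ring) t ⟨t.2, le_rfl⟩
  have h1 : f t * Complex.exp (-((t : ℝ) * z)) = 1 := by simpa [hF, h0] using hcst
  rw [Complex.exp_neg] at h1
  simpa using (mul_inv_eq_one₀ (Complex.exp_ne_zero _)).1 h1

/-- Divide by `t` and let `t` tend to `0` from the right: the difference quotient tends to `z - w`.
Bounds on characteristic functions that are linear in time thus become bounds on exponents. -/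
theorem norm_sub_le_of_norm_exp_sub_exp_le {z w : ℂ} {K : ℝ}
    (h : ∀ t : ℝ≥0, ‖Complex.exp (t * z) - Complex.exp (t * w)‖ ≤ t * K) : ‖z - w‖ ≤ K := by
  have hE : ∀ z : ℂ, HasDerivAt (fun x : ℝ ↦ Complex.exp (x * z)) z 0 := fun z ↦ by
    have := ((hasDerivAt_id (0 : ℝ)).ofReal_comp.mul_const z).cexp
    simpa using this
  have hd : HasDerivWithinAt (fun x : ℝ ↦ Complex.exp (x * z) - Complex.exp (x * w)) (z - w)
      (Set.Ioi 0) 0 := ((hE z).sub (hE w)).hasDerivWithinAt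
  rw [hasDerivWithinAt_iff_tendsto_slope' (by simp)] at hd
  refine le_of_tendsto hd.norm ?_
  filter_upwards [self_mem_nhdsWithin] with x hx
  have hx' : (0 : ℝ) < x := hx
  have := h ⟨x, hx'.le⟩
  simp only [slope, vsub_eq_sub, sub_zero, Complex.ofReal_zero, zero_mul, Complex.exp_zero,
    sub_self, norm_smul, norm_inv, Real.norm_eq_abs, abs_of_pos hx']
  rw [inv_mul_le_iff₀ hx']
  exact this

/-- Taylor's estimate handles `|y| ≤ 1`; beyond that the triangle inequality gives `2 * |y|`, which
is at most `2 * y ^ 2`. -/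
theorem norm_exp_I_mul_sub_one_sub_le (y : ℝ) :
    ‖Complex.exp (Complex.I * y) - 1 - Complex.I * y‖ ≤ 2 * y ^ 2 := by
  rcases le_or_gt |y| 1 with hy | hy
  · have h := Complex.norm_exp_sub_one_sub_id_le (x := Complex.I * y) (by simpa using hy)
    have h2 : ‖Complex.I * (y : ℂ)‖ ^ 2 = y ^ 2 := by simp
    nlinarith [sq_nonneg y]
  · have h1 : ‖Complex.exp (Complex.I * y) - 1‖ ≤ |y| :=
      Real.norm_exp_I_mul_ofReal_sub_one_le
    have h2 : ‖Complex.I * (y : ℂ)‖ = |y| := by simp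
    have h3 := norm_sub_le (Complex.exp (Complex.I * y) - 1) (Complex.I * y)
    nlinarith [sq_abs y]

theorem norm_exp_I_mul_sub_exp_I_mul_le (x y : ℝ) :
    ‖Complex.exp (Complex.I * x) - Complex.exp (Complex.I * y)‖ ≤ |x - y| := by
  have h : Complex.exp (Complex.I * x) - Complex.exp (Complex.I * y) =
      Complex.exp (Complex.I * y) * (Complex.exp (Complex.I * ((x - y : ℝ) : ℂ)) - 1) := by
    rw [mul_sub, ← Complex.exp_add, mul_one]
    push_cast
    ring_nf
  rw [h, norm_mul, Complex.norm_exp_I_mul_ofReal, one_mul]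
  exact Real.norm_exp_I_mul_ofReal_sub_one_le

/-- The subtracted linear term will have mean zero, so only a bound quadratic in `x` is left to
integrate. Factoring out `exp (I * v * x)` leaves a Taylor remainder, contributing the constant `2`,
and a product of two first-order differences, contributing `1`. -/
theorem norm_exp_I_mul_sub_sub_le (u v x : ℝ) :
    ‖Complex.exp (Complex.I * (u * x : ℝ)) - Complex.exp (Complex.I * (v * x : ℝ)) -
      Complex.I * ((u - v) * x : ℝ)‖ ≤ 3 * (|u - v| * (|u| + |v|)) * x ^ 2 := by
  have h : Complex.exp (Complex.I * (u * x : ℝ)) - Complex.exp (Complex.I * (v * x : ℝ)) -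
      Complex.I * ((u - v) * x : ℝ) =
      (Complex.exp (Complex.I * ((u - v) * x : ℝ)) - 1 - Complex.I * ((u - v) * x : ℝ)) +
      (Complex.exp (Complex.I * (v * x : ℝ)) - 1) *
        (Complex.exp (Complex.I * ((u - v) * x : ℝ)) - 1) := by
    have : Complex.exp (Complex.I * (u * x : ℝ)) = Complex.exp (Complex.I * (v * x : ℝ)) *
        Complex.exp (Complex.I * ((u - v) * x : ℝ)) := by
      rw [← Complex.exp_add]
      push_cast
      ring_nf
    rw [this]
    ring
  rw [h]
  have h1 := norm_exp_I_mul_sub_one_sub_le ((u - v) * x)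
  have h2 : ‖Complex.exp (Complex.I * (v * x : ℝ)) - 1‖ ≤ |v * x| :=
    Real.norm_exp_I_mul_ofReal_sub_one_le
  have h3 : ‖Complex.exp (Complex.I * ((u - v) * x : ℝ)) - 1‖ ≤ |(u - v) * x| :=
    Real.norm_exp_I_mul_ofReal_sub_one_le
  refine (norm_add_le _ _).trans ?_
  rw [norm_mul]
  have h4 := mul_le_mul h2 h3 (norm_nonneg _) (abs_nonneg _)
  rw [abs_mul, abs_mul] at h4
  have h5 : |v| * |x| * (|u - v| * |x|) = |v| * |u - v| * x ^ 2 := by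
    rw [← sq_abs x]; ring
  have h6 : 2 * ((u - v) * x) ^ 2 ≤ 2 * (|u - v| * (|u| + |v|)) * x ^ 2 := by
    rw [mul_pow, ← mul_assoc]
    gcongr
    rw [← sq_abs, sq]
    gcongr
    exact abs_sub u v
  have h7 : |v| * |u - v| * x ^ 2 ≤ |u - v| * (|u| + |v|) * x ^ 2 := by
    rw [mul_comm |v|]
    gcongr
    linarith [abs_nonneg u]
  linarith

/-- Nonnegativity makes `V` monotone. Sandwiching `n * t` between consecutive integers bounds `n *
|V t - t * V 1|` by `V 1` for every `n`, so the difference vanishes. -/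
theorem eq_mul_of_additive_of_nonneg {V : ℝ≥0 → ℝ} (hadd : ∀ s t, V (s + t) = V s + V t)
    (hV : ∀ t, 0 ≤ V t) (t : ℝ≥0) : V t = t * V 1 := by
  have hmono : ∀ {s t}, s ≤ t → V s ≤ V t := fun {s t} h ↦ by
    rw [← add_tsub_cancel_of_le h, hadd]
    linarith [hV (t - s)]
  have h0 : V 0 = 0 := by simpa using hadd 0 0
  have hn : ∀ (n : ℕ) (s : ℝ≥0), V (n * s) = n * V s := fun n s ↦ by
    induction n with
    | zero => simp [h0]
    | succ n ih => push_cast; rw [add_mul, hadd, ih]; simp; ring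
  have hk : ∀ k : ℕ, V k = k * V 1 := fun k ↦ by simpa using hn k 1
  have key : ∀ n : ℕ, n * |V t - t * V 1| ≤ V 1 := by
    intro n
    have h1 := hmono (Nat.floor_le (zero_le (a := (n : ℝ≥0) * t)))
    have h2 := hmono (Nat.lt_floor_add_one ((n : ℝ≥0) * t)).le
    have h3 : ((⌊(n : ℝ≥0) * t⌋₊ : ℕ) : ℝ) ≤ n * t := by
      exact_mod_cast Nat.floor_le (zero_le (a := (n : ℝ≥0) * t))
    have h4 : (n * t : ℝ) ≤ ((⌊(n : ℝ≥0) * t⌋₊ : ℕ) : ℝ) + 1 := by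
      exact_mod_cast (Nat.lt_floor_add_one ((n : ℝ≥0) * t)).le
    have h5 : V (((⌊(n : ℝ≥0) * t⌋₊ : ℕ) : ℝ≥0) + 1) =
        (((⌊(n : ℝ≥0) * t⌋₊ : ℕ) : ℝ) + 1) * V 1 := by
      rw [hadd, hk]; ring
    rw [hk, hn] at h1
    rw [h5, hn] at h2
    rw [← Nat.abs_cast n, ← abs_mul, abs_le]
    constructor <;> nlinarith [hV 1]
  by_contra hne
  have hpos : 0 < |V t - t * V 1| := abs_pos.2 (sub_ne_zero.2 hne)
  obtain ⟨n, hn⟩ := exists_nat_gt (V 1 / |V t - t * V 1|)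
  rw [div_lt_iff₀ hpos] at hn
  linarith [key n]

/-! ### Second moments of finite sums. -/

section L2

variable {α E ι : Type*} {m : MeasurableSpace α} {μ : Measure α} [NormedAddCommGroup E]

theorem eLpNorm_two_eq_ofReal_sqrt {f : α → E} (hf : MemLp f 2 μ) :
    eLpNorm f 2 μ = ENNReal.ofReal (√(∫ x, ‖f x‖ ^ 2 ∂μ)) := by
  rw [hf.eLpNorm_eq_integral_rpow_norm two_ne_zero ENNReal.ofNat_ne_top, Real.sqrt_eq_rpow]
  simp

theorem MemLp.finsetSum_smul_const [NormedSpace ℝ E] [Fintype ι] {X : ι → α → ℝ}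
    (hX : ∀ i, MemLp (X i) 2 μ) (v : ι → E) : MemLp (fun x ↦ ∑ i, X i x • v i) 2 μ :=
  memLp_finsetSum _ fun i _ ↦ by
    have := (ContinuousLinearMap.toSpanSingleton ℝ (v i)).comp_memLp' (hX i)
    simpa [Function.comp_def] using this

/-- Used both on `Ω` and on `[0, t]`: it reduces the vector-valued isometry to comparing scalar Gram
matrices. -/
theorem integral_norm_sq_finsetSum_smul [InnerProductSpace ℝ E] [Fintype ι] {X : ι → α → ℝ}
    (hX : ∀ i, MemLp (X i) 2 μ) (v : ι → E) :
    ∫ x, ‖∑ i, X i x • v i‖ ^ 2 ∂μ =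
      ∑ i, ∑ j, (∫ x, X i x * X j x ∂μ) * inner ℝ (v i) (v j) := by
  have h : ∀ x, ‖∑ i, X i x • v i‖ ^ 2 = ∑ i, ∑ j, X i x * X j x * inner ℝ (v i) (v j) := by
    intro x
    rw [← real_inner_self_eq_norm_sq, sum_inner]
    refine Finset.sum_congr rfl fun i _ ↦ ?_
    rw [inner_sum]
    refine Finset.sum_congr rfl fun j _ ↦ ?_
    rw [real_inner_smul_left, real_inner_smul_right]
    ring
  have hi : ∀ i j, Integrable (fun x ↦ X i x * X j x * inner ℝ (v i) (v j)) μ := fun i j ↦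
    ((hX i).integrable_mul (hX j)).mul_const _
  simp_rw [h]
  rw [integral_finsetSum _ fun i _ ↦ integrable_finsetSum _ fun j _ ↦ hi i j]
  refine Finset.sum_congr rfl fun i _ ↦ ?_
  rw [integral_finsetSum _ fun j _ ↦ hi i j]
  exact Finset.sum_congr rfl fun j _ ↦ integral_mul_const _ _

theorem integral_sub_mul_sub {x y z w : α → ℝ} (hxz : Integrable (fun a ↦ x a * z a) μ)
    (hxw : Integrable (fun a ↦ x a * w a) μ) (hyz : Integrable (fun a ↦ y a * z a) μ)
    (hyw : Integrable (fun a ↦ y a * w a) μ) :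
    ∫ a, (x a - y a) * (z a - w a) ∂μ =
      ((∫ a, x a * z a ∂μ) - ∫ a, x a * w a ∂μ) -
        ((∫ a, y a * z a ∂μ) - ∫ a, y a * w a ∂μ) := by
  rw [← integral_sub hxz hxw, ← integral_sub hyz hyw, ← integral_sub]
  · refine integral_congr_ae (ae_of_all _ fun a ↦ ?_)
    simp only
    ring
  · exact hxz.sub hxw
  · exact hyz.sub hyw

end L2

/-! ### Covariances and the Itô isometry. -/

namespace IsLevyProcess

variable {Ω : Type*} {mΩ : MeasurableSpace Ω} {P : Measure Ω}
  {𝓕 : Filtration ℝ≥0 mΩ} {U : ℝ≥0 → Ω → ℝ}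

theorem measurable (hU : IsLevyProcess 𝓕 P U) (t : ℝ≥0) : Measurable (U t) :=
  (hU.adapted t).mono (𝓕.le t) le_rfl

theorem indepFun (hU : IsLevyProcess 𝓕 P U) {s t : ℝ≥0} (hst : s ≤ t) {Z : Ω → ℝ}
    (hZ : Measurable[𝓕 s] Z) : IndepFun (fun ω ↦ U t ω - U s ω) Z P := by
  rw [IndepFun_iff_Indep]
  exact indep_of_indep_of_le_right (hU.indep_increments s t hst) hZ.comap_le

theorem integral_increment_mul (hU : IsLevyProcess 𝓕 P U)
    (hvar : ∀ t, MemLp (U t) 2 P) [IsFiniteMeasure P] (hmean : ∀ t, ∫ ω, U t ω ∂P = 0)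
    {s t : ℝ≥0} (hst : s ≤ t) :
    ∫ ω, (U t ω - U s ω) * U s ω ∂P = 0 := by
  have hi : ∀ t, Integrable (U t) P := fun t ↦ (hvar t).integrable (by norm_num)
  rw [(hU.indepFun hst (hU.adapted s)).integral_fun_mul_eq_mul_integral
    ((hU.measurable t).sub (hU.measurable s)).aestronglyMeasurable
    (hU.measurable s).aestronglyMeasurable, hmean, mul_zero]

theorem integral_mul_of_le (hU : IsLevyProcess 𝓕 P U)
    (hvar : ∀ t, MemLp (U t) 2 P) [IsFiniteMeasure P] (hmean : ∀ t, ∫ ω, U t ω ∂P = 0)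
    {s t : ℝ≥0} (hst : s ≤ t) :
    ∫ ω, U s ω * U t ω ∂P = ∫ ω, U s ω ^ 2 ∂P := by
  have h : ∀ ω, U s ω * U t ω = (U t ω - U s ω) * U s ω + U s ω ^ 2 := fun ω ↦ by ring
  have h1 : Integrable (fun ω ↦ (U t ω - U s ω) * U s ω) P :=
    ((hvar t).sub (hvar s)).integrable_mul (hvar s)
  simp_rw [h]
  rw [integral_add h1 (hvar s).integrable_sq,
    hU.integral_increment_mul hvar hmean hst, zero_add]

/-- An increment is orthogonal to the past and distributed as `U t`, so second moments add up over
time. -/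
theorem integral_sq (hU : IsLevyProcess 𝓕 P U)
    (hvar : ∀ t, MemLp (U t) 2 P) [IsFiniteMeasure P] (hmean : ∀ t, ∫ ω, U t ω ∂P = 0)
    (t : ℝ≥0) : ∫ ω, U t ω ^ 2 ∂P = t * ∫ ω, U 1 ω ^ 2 ∂P := by
  refine eq_mul_of_additive_of_nonneg (V := fun t ↦ ∫ ω, U t ω ^ 2 ∂P) (fun s t ↦ ?_)
    (fun t ↦ integral_nonneg fun _ ↦ sq_nonneg _) t
  have h : ∀ ω, U (s + t) ω ^ 2 =
      U s ω ^ 2 + (U (s + t) ω - U s ω) ^ 2 + 2 * ((U (s + t) ω - U s ω) * U s ω) :=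
    fun ω ↦ by ring
  have hinc : MemLp (fun ω ↦ U (s + t) ω - U s ω) 2 P := (hvar _).sub (hvar _)
  have h1 : Integrable (fun ω ↦ U s ω ^ 2 + (U (s + t) ω - U s ω) ^ 2) P :=
    (hvar s).integrable_sq.add hinc.integrable_sq
  have h2 : Integrable (fun ω ↦ 2 * ((U (s + t) ω - U s ω) * U s ω)) P :=
    (hinc.integrable_mul (hvar s)).const_mul 2
  simp_rw [h]
  rw [integral_add h1 h2,
    integral_add (hvar s).integrable_sq hinc.integrable_sq, integral_const_mul,
    hU.integral_increment_mul hvar hmean le_self_add, mul_zero, add_zero]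
  congr 1
  exact ((hU.stationary_increments s t).comp (measurable_id.pow_const 2)).integral_eq

theorem integral_mul (hU : IsLevyProcess 𝓕 P U)
    (hvar : ∀ t, MemLp (U t) 2 P) [IsFiniteMeasure P] (hmean : ∀ t, ∫ ω, U t ω ∂P = 0)
    (s t : ℝ≥0) : ∫ ω, U s ω * U t ω ∂P = (∫ ω, U 1 ω ^ 2 ∂P) * min s t := by
  rcases le_total s t with h | h
  · rw [hU.integral_mul_of_le hvar hmean h, hU.integral_sq hvar hmean, mul_comm]
    simp [h]
  · simp_rw [mul_comm (U s _)]
    rw [hU.integral_mul_of_le hvar hmean h, hU.integral_sq hvar hmean, mul_comm]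
    simp [h]

/-- Writing increments and indicators as differences based at `0` makes both sides the same
combination of `min` values. Overlapping intervals need no subdivision. -/
theorem integral_increment_mul_increment (hU : IsLevyProcess 𝓕 P U)
    (hvar : ∀ t, MemLp (U t) 2 P) [IsFiniteMeasure P] (hmean : ∀ t, ∫ ω, U t ω ∂P = 0)
    {a b a' b' t : ℝ≥0} (hab : a ≤ b) (hab' : a' ≤ b') (hb : b ≤ t) :
    ∫ ω, (U b ω - U a ω) * (U b' ω - U a' ω) ∂P = (∫ ω, U 1 ω ^ 2 ∂P) *
      ∫ s in Set.Icc 0 t, (Set.Ioc a b).indicator (fun _ ↦ (1 : ℝ)) s *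
        (Set.Ioc a' b').indicator (fun _ ↦ (1 : ℝ)) s ∂lebesgue := by
  have hind : ∀ {a b : ℝ≥0}, a ≤ b → ∀ s, (Set.Ioc a b).indicator (fun _ ↦ (1 : ℝ)) s =
      (Set.Ioc 0 b).indicator (fun _ ↦ (1 : ℝ)) s -
        (Set.Ioc 0 a).indicator (fun _ ↦ (1 : ℝ)) s := by
    intro a b hab s
    by_cases h1 : s ≤ b
    · by_cases h2 : s ≤ a
      · simp [Set.indicator_apply, h1, h2, h2.not_gt]
      · have h3 : 0 < s := zero_le.trans_lt (not_le.1 h2)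
        simp [h1, h2, not_le.1 h2, h3]
    · have h2 : ¬ s ≤ a := fun h ↦ h1 (h.trans hab)
      simp [h1, h2]
  have hI : ∀ c d : ℝ≥0, Integrable (fun s ↦ (Set.Ioc 0 c).indicator (fun _ ↦ (1 : ℝ)) s *
      (Set.Ioc 0 d).indicator (fun _ ↦ (1 : ℝ)) s) (lebesgue.restrict (Set.Icc 0 t)) := by
    intro c d
    have : (fun s ↦ (Set.Ioc 0 c).indicator (fun _ ↦ (1 : ℝ)) s *
      (Set.Ioc 0 d).indicator (fun _ ↦ (1 : ℝ)) s) =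
      (Set.Ioc 0 (min c d)).indicator (fun _ ↦ (1 : ℝ)) := by
        ext s
        rw [← Set.inter_indicator_mul, Set.Ioc_inter_Ioc]
        simp
    rw [this]
    exact integrable_indicator_Ioc _ _ _ _
  have hJ : ∀ c d : ℝ≥0, Integrable (fun ω ↦ U c ω * U d ω) P := fun c d ↦
    (hvar c).integrable_mul (hvar d)
  simp_rw [hind hab, hind hab']
  rw [integral_sub_mul_sub (hJ _ _) (hJ _ _) (hJ _ _) (hJ _ _),
    integral_sub_mul_sub (hI _ _) (hI _ _) (hI _ _) (hI _ _),
    integral_indicator_Ioc_mul_indicator_Ioc hb, integral_indicator_Ioc_mul_indicator_Ioc hb,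
    integral_indicator_Ioc_mul_indicator_Ioc (hab.trans hb),
    integral_indicator_Ioc_mul_indicator_Ioc (hab.trans hb)]
  simp only [hU.integral_mul hvar hmean]
  ring

/-- The Itô isometry for elementary integrals. -/
theorem eLpNorm_sum_increment_smul (hU : IsLevyProcess 𝓕 P U)
    (hvar : ∀ t, MemLp (U t) 2 P) [IsFiniteMeasure P] (hmean : ∀ t, ∫ ω, U t ω ∂P = 0)
    {E ι : Type*} [NormedAddCommGroup E] [InnerProductSpace ℝ E] [Fintype ι] {t : ℝ≥0}
    {a b : ι → ℝ≥0} (hab : ∀ i, a i ≤ b i) (hb : ∀ i, b i ≤ t) (v : ι → E) :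
    eLpNorm (fun ω ↦ ∑ i, (U (b i) ω - U (a i) ω) • v i) 2 P =
      ENNReal.ofReal (√(∫ ω, U 1 ω ^ 2 ∂P)) *
        eLpNorm (fun s ↦ ∑ i, (Set.Ioc (a i) (b i)).indicator (fun _ ↦ v i) s) 2
          (lebesgue.restrict (Set.Icc 0 t)) := by
  have h1 : ∀ i, MemLp (fun ω ↦ U (b i) ω - U (a i) ω) 2 P := fun i ↦ (hvar _).sub (hvar _)
  have h2 : ∀ i, MemLp ((Set.Ioc (a i) (b i)).indicator (fun _ ↦ (1 : ℝ))) 2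
      (lebesgue.restrict (Set.Icc 0 t)) := fun i ↦ (memLp_const 1).indicator measurableSet_Ioc
  have h3 : (fun s ↦ ∑ i, (Set.Ioc (a i) (b i)).indicator (fun _ ↦ v i) s) =
      fun s ↦ ∑ i, (Set.Ioc (a i) (b i)).indicator (fun _ ↦ (1 : ℝ)) s • v i := by
    ext s
    refine Finset.sum_congr rfl fun i _ ↦ ?_
    by_cases h : s ∈ Set.Ioc (a i) (b i) <;> simp [h]
  rw [h3, eLpNorm_two_eq_ofReal_sqrt (MemLp.finsetSum_smul_const h1 v),
    eLpNorm_two_eq_ofReal_sqrt (MemLp.finsetSum_smul_const h2 v),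
    ← ENNReal.ofReal_mul (Real.sqrt_nonneg _),
    ← Real.sqrt_mul (integral_nonneg fun _ ↦ sq_nonneg _),
    integral_norm_sq_finsetSum_smul h1, integral_norm_sq_finsetSum_smul h2]
  simp_rw [Finset.mul_sum, ← mul_assoc]
  congr 2
  refine Finset.sum_congr rfl fun i _ ↦ Finset.sum_congr rfl fun j _ ↦ ?_
  rw [hU.integral_increment_mul_increment hvar hmean (hab i) (hab j) (hb i)]

/-- The Itô isometry for the difference of two elementary integrals. -/
theorem eLpNorm_integral_sub_integral (hU : IsLevyProcess 𝓕 P U)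
    (hvar : ∀ t, MemLp (U t) 2 P) [IsFiniteMeasure P] (hmean : ∀ t, ∫ ω, U t ω ∂P = 0)
    {E : Type*} [NormedAddCommGroup E] [InnerProductSpace ℝ E] {t : ℝ≥0}
    (p q : StepFunction E t) :
    eLpNorm (fun ω ↦ p.integral U ω - q.integral U ω) 2 P =
      ENNReal.ofReal (√(∫ ω, U 1 ω ^ 2 ∂P)) *
        eLpNorm (fun s ↦ p.eval s - q.eval s) 2 (lebesgue.restrict (Set.Icc 0 t)) := by
  -- Concatenating `p` with `-q` over a sum type turns the difference into a single elementary sum.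
  have h := hU.eLpNorm_sum_increment_smul hvar hmean (t := t)
    (a := Sum.elim p.a q.a) (b := Sum.elim p.b q.b)
    (by rintro (i | i) <;> simp [p.a_le_b, q.a_le_b])
    (by rintro (i | i) <;> simp [p.b_le, q.b_le]) (Sum.elim p.v (fun i ↦ -q.v i))
  have hneg : ∀ i s, (Set.Ioc (q.a i) (q.b i)).indicator (fun _ ↦ -q.v i) s =
      -(Set.Ioc (q.a i) (q.b i)).indicator (fun _ ↦ q.v i) s := fun i s ↦ by
    by_cases h : s ∈ Set.Ioc (q.a i) (q.b i) <;> simp [h]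
  simp only [Fintype.sum_sum_type, Sum.elim_inl, Sum.elim_inr, smul_neg, Finset.sum_neg_distrib,
    hneg, ← sub_eq_add_neg] at h
  exact h

end IsLevyProcess

/-! ### The Lévy exponent. -/

namespace IsLevyProcess

variable {Ω : Type*} {mΩ : MeasurableSpace Ω} {P : Measure Ω}
  {𝓕 : Filtration ℝ≥0 mΩ} {U : ℝ≥0 → Ω → ℝ}

theorem integrable_exp_I_mul {α : Type*} {m : MeasurableSpace α} {μ : Measure α}
    [IsFiniteMeasure μ] {f : α → ℝ} (hf : AEStronglyMeasurable f μ) :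
    Integrable (fun ω ↦ Complex.exp (Complex.I * (f ω : ℂ))) μ := by
  refine Integrable.of_bound (C := 1) ?_ (ae_of_all _ fun ω ↦ ?_)
  · exact (by fun_prop : Continuous fun x : ℝ ↦ Complex.exp (Complex.I * (x : ℂ))).comp_aestronglyMeasurable hf
  · rw [Complex.norm_exp_I_mul_ofReal]

theorem integral_exp_increment (hU : IsLevyProcess 𝓕 P U) {s t : ℝ≥0} (hst : s ≤ t) (u : ℝ) :
    ∫ ω, Complex.exp (Complex.I * (u * (U t ω - U s ω) : ℝ)) ∂P =
      ∫ ω, Complex.exp (Complex.I * (u * U (t - s) ω : ℝ)) ∂P := by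
  have h := (hU.stationary_increments s (t - s)).comp
    (by fun_prop : Measurable fun x : ℝ ↦ Complex.exp (Complex.I * (u * x : ℝ)))
  rw [add_tsub_cancel_of_le hst] at h
  exact h.integral_eq

theorem integral_exp_add_increment (hU : IsLevyProcess 𝓕 P U) [IsProbabilityMeasure P]
    {s t : ℝ≥0} (hst : s ≤ t)
    {Z : Ω → ℝ} (hZ : Measurable[𝓕 s] Z) (u : ℝ) :
    ∫ ω, Complex.exp (Complex.I * (Z ω + u * (U t ω - U s ω) : ℝ)) ∂P =
      (∫ ω, Complex.exp (Complex.I * (Z ω : ℝ)) ∂P) *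
        ∫ ω, Complex.exp (Complex.I * (u * U (t - s) ω : ℝ)) ∂P := by
  rw [← hU.integral_exp_increment hst, mul_comm]
  have h := (hU.indepFun hst hZ).integral_fun_comp_mul_comp
    (f := fun x : ℝ ↦ Complex.exp (Complex.I * (u * x : ℝ)))
    (g := fun x : ℝ ↦ Complex.exp (Complex.I * (x : ℝ)))
    ((hU.measurable t).sub (hU.measurable s)).aemeasurable
    (hZ.mono (𝓕.le s) le_rfl).aemeasurable
    (by fun_prop : Continuous _).aestronglyMeasurable
    (by fun_prop : Continuous _).aestronglyMeasurable
  rw [← h]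
  refine integral_congr_ae (ae_of_all _ fun ω ↦ ?_)
  simp only
  rw [← Complex.exp_add]
  push_cast
  ring_nf

/-- The linear Taylor term integrates to zero by centring, and the quadratic remainder brings in the
second moment `t * σ²`, whence the factor `t`. -/
theorem norm_integral_exp_sub_le (hU : IsLevyProcess 𝓕 P U) [IsProbabilityMeasure P]
    (hvar : ∀ t, MemLp (U t) 2 P) (hmean : ∀ t, ∫ ω, U t ω ∂P = 0) (t : ℝ≥0) (u v : ℝ) :
    ‖(∫ ω, Complex.exp (Complex.I * (u * U t ω : ℝ)) ∂P) -
      ∫ ω, Complex.exp (Complex.I * (v * U t ω : ℝ)) ∂P‖ ≤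
      t * (3 * (∫ ω, U 1 ω ^ 2 ∂P) * (|u - v| * (|u| + |v|))) := by
  have hi : Integrable (U t) P := (hvar t).integrable (by norm_num)
  have h0 : ∫ ω, Complex.I * (((u - v) * U t ω : ℝ) : ℂ) ∂P = 0 := by
    rw [integral_const_mul, integral_complex_ofReal, integral_const_mul, hmean]
    simp
  have he : ∀ w : ℝ, Integrable (fun ω ↦ Complex.exp (Complex.I * (w * U t ω : ℝ))) P := fun w ↦
    integrable_exp_I_mul (hi.const_mul w).aestronglyMeasurable
  have hl : Integrable (fun ω ↦ Complex.I * (((u - v) * U t ω : ℝ) : ℂ)) P :=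
    (hi.const_mul (u - v)).ofReal.const_mul _
  have key : (∫ ω, Complex.exp (Complex.I * (u * U t ω : ℝ)) ∂P) -
      ∫ ω, Complex.exp (Complex.I * (v * U t ω : ℝ)) ∂P =
      ∫ ω, (Complex.exp (Complex.I * (u * U t ω : ℝ)) - Complex.exp (Complex.I * (v * U t ω : ℝ)) -
        Complex.I * (((u - v) * U t ω : ℝ) : ℂ)) ∂P := by
    have hs : Integrable (fun ω ↦ Complex.exp (Complex.I * (u * U t ω : ℝ)) -
        Complex.exp (Complex.I * (v * U t ω : ℝ))) P := (he u).sub (he v)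
    rw [integral_sub hs hl, integral_sub (he u) (he v), h0, sub_zero]
  rw [key]
  refine (norm_integral_le_of_norm_le ((hvar t).integrable_sq.const_mul
    (3 * (|u - v| * (|u| + |v|)))) (ae_of_all _ fun ω ↦ norm_exp_I_mul_sub_sub_le u v (U t ω))).trans
    (le_of_eq ?_)
  rw [integral_const_mul, hU.integral_sq hvar hmean]
  ring

/-- The Lévy exponent of a centred square integrable Lévy process. -/
theorem exists_exponent (hU : IsLevyProcess 𝓕 P U) [IsProbabilityMeasure P]
    (hvar : ∀ t, MemLp (U t) 2 P) (hmean : ∀ t, ∫ ω, U t ω ∂P = 0) :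
    ∃ (ψ : ℝ → ℂ) (K : ℝ), 0 ≤ K ∧ ψ 0 = 0 ∧
      (∀ u v, ‖ψ u - ψ v‖ ≤ K * (|u - v| * (|u| + |v|))) ∧
      ∀ (t : ℝ≥0) (u : ℝ),
        ∫ ω, Complex.exp (Complex.I * (u * U t ω : ℝ)) ∂P = Complex.exp (t * ψ u) := by
  set φ : ℝ → ℝ≥0 → ℂ := fun u t ↦ ∫ ω, Complex.exp (Complex.I * (u * U t ω : ℝ)) ∂P with hφ
  have hφ0 : ∀ t, φ 0 t = 1 := fun t ↦ by simp [hφ]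
  have hφ00 : ∀ u, φ u 0 = 1 := fun u ↦ by
    have : ∀ᵐ ω ∂P, Complex.exp (Complex.I * (u * U 0 ω : ℝ)) = 1 := by
      filter_upwards [hU.zero] with ω h
      simp [h]
    simp only [hφ]
    rw [integral_congr_ae this]
    simp
  have hadd : ∀ u s t, φ u (s + t) = φ u s * φ u t := fun u s t ↦ by
    have h := hU.integral_exp_add_increment (le_self_add : s ≤ s + t)
      ((hU.adapted s).const_mul u) u
    rw [add_tsub_cancel_left] at h
    rw [hφ]
    simp only
    rw [← h]
    refine integral_congr_ae (ae_of_all _ fun ω ↦ ?_)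
    simp only
    congr 3
    ring
  have hle : ∀ u t, ‖φ u t‖ ≤ 1 := fun u t ↦ by
    refine (norm_integral_le_of_norm_le (integrable_const (1 : ℝ))
      (ae_of_all _ fun ω ↦ by rw [Complex.norm_exp_I_mul_ofReal])).trans (by simp)
  have hbd := hU.norm_integral_exp_sub_le hvar hmean
  -- Comparing `u` with `0` bounds `φ u (t - s) - 1` by a multiple of `t - s`; the semigroup law
  -- then makes `φ u` Lipschitz in time.
  have hcont : ∀ u, Continuous (φ u) := fun u ↦ by
    set L := 3 * (∫ ω, U 1 ω ^ 2 ∂P) * (|u - 0| * (|u| + |(0 : ℝ)|)) with hL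
    have hL0 : 0 ≤ L := by
      have : 0 ≤ ∫ ω, U 1 ω ^ 2 ∂P := integral_nonneg fun _ ↦ sq_nonneg _
      positivity
    have hst : ∀ s t, s ≤ t → dist (φ u s) (φ u t) ≤ L * dist s t := by
      intro s t hst
      have h1 : φ u t = φ u s * φ u (t - s) := by rw [← hadd, add_tsub_cancel_of_le hst]
      have h2 : ‖φ u (t - s) - φ 0 (t - s)‖ ≤ ((t - s : ℝ≥0) : ℝ) * L := hbd (t - s) u 0
      rw [hφ0] at h2
      rw [dist_comm, dist_eq_norm, h1, ← mul_sub_one, norm_mul, dist_comm, NNReal.dist_eq,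
        ← NNReal.coe_sub hst, NNReal.abs_eq, mul_comm L]
      exact (mul_le_of_le_one_left (norm_nonneg _) (hle _ _)).trans h2
    refine LipschitzWith.continuous (K := ⟨L, hL0⟩) (LipschitzWith.of_dist_le_mul fun s t ↦ ?_)
    rcases le_total s t with h | h
    · exact hst s t h
    · rw [dist_comm, dist_comm s]; exact hst t s h
  choose ψ hψ using fun u ↦ exists_eq_exp_of_continuous_semigroup (hcont u) (hφ00 u) (hadd u)
  refine ⟨ψ, 3 * ∫ ω, U 1 ω ^ 2 ∂P,
    mul_nonneg (by norm_num) (integral_nonneg fun _ ↦ sq_nonneg _), ?_, fun u v ↦ ?_,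
    fun t u ↦ hψ u t⟩
  -- `exp (t * ψ 0) = 1` for all `t`, not just `t = 1`, excludes nonzero multiples of `2πi`.
  · have := norm_sub_le_of_norm_exp_sub_exp_le (z := ψ 0) (w := 0) (K := 0) fun t ↦ by
      rw [← hψ, hφ0]; simp
    simpa using this
  · refine norm_sub_le_of_norm_exp_sub_exp_le fun t ↦ ?_
    rw [← hψ, ← hψ]
    exact hbd t u v

/-- Induction on `n`: the sum of the first `n` terms is known at time `τ n`, so the next increment
is independent of it and contributes a factor. -/
theorem integral_exp_sum_increment (hU : IsLevyProcess 𝓕 P U) [IsProbabilityMeasure P]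
    {ψ : ℝ → ℂ} (hψ : ∀ (t : ℝ≥0) (u : ℝ),
        ∫ ω, Complex.exp (Complex.I * (u * U t ω : ℝ)) ∂P = Complex.exp (t * ψ u))
    {τ : ℕ → ℝ≥0} (hτ : Monotone τ) (x : ℕ → ℝ) (n : ℕ) :
    ∫ ω, Complex.exp (Complex.I *
      ((∑ i ∈ Finset.range n, x i * (U (τ (i + 1)) ω - U (τ i) ω) : ℝ) : ℂ)) ∂P =
      Complex.exp (∑ i ∈ Finset.range n, ((τ (i + 1) - τ i : ℝ≥0) : ℂ) * ψ (x i)) := by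
  induction n with
  | zero => simp
  | succ n ih =>
    simp_rw [Finset.sum_range_succ]
    have hm : Measurable[𝓕 (τ n)]
        fun ω ↦ ∑ i ∈ Finset.range n, x i * (U (τ (i + 1)) ω - U (τ i) ω) := by
      refine Finset.measurable_sum _ fun i hi ↦ Measurable.const_mul (Measurable.sub ?_ ?_) _
      · exact (hU.adapted _).mono (𝓕.mono (hτ (Finset.mem_range.1 hi))) le_rfl
      · exact (hU.adapted _).mono (𝓕.mono (hτ (Finset.mem_range.1 hi).le)) le_rfl
    rw [hU.integral_exp_add_increment (hτ n.le_succ) hm, ih, hψ, Complex.exp_add]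

end IsLevyProcess

/-! ### Density of step functions. -/

namespace StepFunction

variable {E : Type*} [NormedAddCommGroup E] {t : ℝ≥0}

/-- The step function with value `v i` on the interval `(τ i, τ (i + 1)]`, for `i < n`. -/
def ofPartition (τ : ℕ → ℝ≥0) (hτ : Monotone τ) (n : ℕ) (hn : τ n ≤ t) (v : ℕ → E) :
    StepFunction E t where
  n := n
  a i := τ i
  b i := τ (i + 1)
  v i := v i
  a_le_b i := hτ (Nat.le_succ i)
  b_le i := (hτ i.2).trans hn

theorem eval_ofPartition_of_mem {τ : ℕ → ℝ≥0} (hτ : Monotone τ) {n : ℕ} (hn : τ n ≤ t)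
    (v : ℕ → E) {i : ℕ} (hi : i < n) {s : ℝ≥0} (hs : s ∈ Set.Ioc (τ i) (τ (i + 1))) :
    (ofPartition τ hτ n hn v).eval s = v i := by
  have h : ∀ j : Fin n, j ≠ ⟨i, hi⟩ →
      (Set.Ioc (τ j) (τ (j + 1))).indicator (fun _ ↦ v j) s = 0 := fun j hj ↦ by
    refine Set.indicator_of_notMem (fun hsj ↦ ?_) _
    exact Set.disjoint_left.1 (hτ.pairwise_disjoint_on_Ioc_succ
      (fun h : (j : ℕ) = i ↦ hj (Fin.ext h))) hsj hs
  calc (ofPartition τ hτ n hn v).eval s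
      = ∑ j : Fin n, (Set.Ioc (τ j) (τ (j + 1))).indicator (fun _ ↦ v j) s := rfl
    _ = v i := by
        rw [Finset.sum_eq_single ⟨i, hi⟩ (fun j _ hj ↦ h j hj) (by simp)]
        exact Set.indicator_of_mem hs _

/-- Uniform continuity on `[0, t]`, sampling at right endpoints of an equal partition. The point `0`
is left out because it lies in no left-open cell. -/
theorem exists_ofPartition_norm_sub_le {k : ℝ≥0 → E} (hk : Continuous k) (t : ℝ≥0) {ε : ℝ}
    (hε : 0 < ε) : ∃ (τ : ℕ → ℝ≥0) (hτ : Monotone τ) (n : ℕ) (hn : τ n ≤ t) (v : ℕ → E),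
      ∀ s ∈ Set.Ioc 0 t, ‖k s - (ofPartition τ hτ n hn v).eval s‖ ≤ ε := by
  obtain ⟨δ, hδ, H⟩ := Metric.uniformContinuousOn_iff.1
    (isCompact_Icc.uniformContinuousOn_of_continuous
      (hk.continuousOn (s := Set.Icc (0 : ℝ≥0) t))) ε hε
  obtain ⟨m, hm⟩ := exists_nat_gt ((t : ℝ) / δ)
  have hm0 : (0 : ℝ) < ((m + 1 : ℕ) : ℝ) := by positivity
  have hm0' : ((m + 1 : ℕ) : ℝ≥0) ≠ 0 := by positivity
  have hlt : (t : ℝ) / ((m + 1 : ℕ) : ℝ) < δ := by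
    rw [div_lt_iff₀ hδ] at hm
    rw [div_lt_iff₀ hm0]
    push_cast
    linarith
  set τ : ℕ → ℝ≥0 := fun i ↦ i * (t / (m + 1 : ℕ)) with hτdef
  have hτ : Monotone τ := fun i j hij ↦ by
    simp only [hτdef]
    gcongr
  have hn : τ (m + 1) = t := by
    simp only [hτdef]
    field_simp
  refine ⟨τ, hτ, m + 1, hn.le, fun i ↦ k (τ (i + 1)), fun s hs ↦ ?_⟩
  have hs' : s ∈ Set.Ioc (τ 0) (τ (m + 1)) := by
    rw [hn]
    simpa [hτdef] using hs
  rw [← hτ.biUnion_Ico_Ioc_map_succ] at hs'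
  simp only [Set.mem_iUnion, Set.mem_Ico] at hs'
  obtain ⟨i, hi, hsi⟩ := hs'
  rw [eval_ofPartition_of_mem hτ hn.le _ hi.2 hsi, ← dist_eq_norm]
  refine (H s ⟨zero_le, hs.2⟩ _ ⟨zero_le, (hτ hi.2).trans hn.le⟩ ?_).le
  refine lt_of_le_of_lt ?_ hlt
  have h1 : (s : ℝ) ≤ (τ (i + 1) : ℝ) := hsi.2
  have h2 : (τ i : ℝ) < s := hsi.1
  have h3 : (τ (i + 1) : ℝ) = τ i + t / ((m + 1 : ℕ) : ℝ) := by
    simp only [hτdef]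
    push_cast
    ring
  rw [NNReal.dist_eq, abs_sub_comm, abs_of_nonneg (by linarith)]
  linarith

/-- Step functions are dense in `L²([0, t]; E)`. -/
theorem exists_ofPartition_eLpNorm_sub_le [NormedSpace ℝ E] {f : ℝ≥0 → E}
    (hf : MemLp f 2 (lebesgue.restrict (Set.Icc 0 t))) {ε : ℝ≥0∞} (hε : ε ≠ 0) :
    ∃ (τ : ℕ → ℝ≥0) (hτ : Monotone τ) (n : ℕ) (hn : τ n ≤ t) (v : ℕ → E),
      eLpNorm (fun s ↦ f s - (ofPartition τ hτ n hn v).eval s) 2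
        (lebesgue.restrict (Set.Icc 0 t)) ≤ ε := by
  set μ := lebesgue.restrict (Set.Icc 0 t)
  have hε2 : ε / 2 ≠ 0 := (ENNReal.half_pos hε).ne'
  obtain ⟨k, hk, -⟩ := hf.exists_boundedContinuous_eLpNorm_sub_le (by simp) hε2
  have hM : μ Set.univ ^ (2 : ℝ≥0∞).toReal⁻¹ ≠ ∞ :=
    ENNReal.rpow_ne_top_of_nonneg (by simp) (measure_ne_top _ _)
  obtain ⟨η, hη, hη'⟩ := ENNReal.exists_nnreal_pos_mul_lt hM hε2
  obtain ⟨τ, hτ, n, hn, v, hv⟩ := exists_ofPartition_norm_sub_le k.continuous t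
    (NNReal.coe_pos.2 hη)
  refine ⟨τ, hτ, n, hn, v, ?_⟩
  set p := ofPartition τ hτ n hn v
  have hp : AEStronglyMeasurable p.eval μ := by
    refine Finset.aestronglyMeasurable_fun_sum _ fun i _ ↦ ?_
    exact (integrable_indicator_Ioc t _ _ _).aestronglyMeasurable
  have h1 : eLpNorm (fun s ↦ k s - p.eval s) 2 μ ≤ ε / 2 := by
    have hae : ∀ᵐ s ∂μ, ‖k s - p.eval s‖ ≤ η := by
      -- The uncovered point `0` is negligible.
      have h0 : ∀ᵐ s ∂μ, s ≠ 0 := by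
        refine ae_restrict_of_ae ?_
        rw [ae_iff]
        simpa using lebesgue_singleton 0
      filter_upwards [h0, ae_restrict_mem measurableSet_Icc] with s hs0 hs
      exact hv s ⟨pos_iff_ne_zero.2 hs0, hs.2⟩
    refine (eLpNorm_le_of_ae_bound hae).trans ?_
    rw [ENNReal.ofReal_coe_nnreal, mul_comm]
    exact hη'.le
  have h2 : (fun s ↦ f s - p.eval s) = (fun s ↦ f s - k s) + fun s ↦ k s - p.eval s := by
    ext s
    simp
  rw [h2]
  have hkm : AEStronglyMeasurable k μ := k.continuous.aestronglyMeasurable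
  calc _ ≤ eLpNorm (fun s ↦ f s - k s) 2 μ + eLpNorm (fun s ↦ k s - p.eval s) 2 μ :=
        eLpNorm_add_le (hf.1.sub hkm) (hkm.sub hp) (by norm_num)
    _ ≤ ε / 2 + ε / 2 := add_le_add hk h1
    _ = ε := ENNReal.add_halves ε

end StepFunction

/-! ### Existence, uniqueness and linear images of the stochastic integral. -/

section

variable {Ω : Type*} {mΩ : MeasurableSpace Ω} {P : Measure Ω}
  {𝓕 : Filtration ℝ≥0 mΩ} {U : ℝ≥0 → Ω → ℝ}
  {E : Type*} [NormedAddCommGroup E]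

namespace StepFunction

theorem memLp_eval [NormedSpace ℝ E] {t : ℝ≥0} (p : StepFunction E t) :
    MemLp p.eval 2 (lebesgue.restrict (Set.Icc 0 t)) :=
  memLp_finsetSum _ fun _ _ ↦ (memLp_const _).indicator measurableSet_Ioc

theorem memLp_integral [NormedSpace ℝ E] {t : ℝ≥0} (p : StepFunction E t)
    (hvar : ∀ t, MemLp (U t) 2 P) : MemLp (p.integral U) 2 P :=
  MemLp.finsetSum_smul_const (fun i ↦ (hvar (p.b i)).sub (hvar (p.a i))) p.v

theorem stronglyMeasurable_integral [NormedSpace ℝ E] {t : ℝ≥0} (p : StepFunction E t)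
    (hU : IsLevyProcess 𝓕 P U) : StronglyMeasurable[𝓕 t] (p.integral U) := by
  refine Finset.stronglyMeasurable_fun_sum _ fun i _ ↦ ?_
  have h : Measurable[𝓕 t] fun ω ↦ U (p.b i) ω - U (p.a i) ω :=
    ((hU.adapted _).mono (𝓕.mono (p.b_le i)) le_rfl).sub
      ((hU.adapted _).mono (𝓕.mono ((p.a_le_b i).trans (p.b_le i))) le_rfl)
  exact h.stronglyMeasurable.smul_const _

theorem eLpNorm_eval_sub_eval_le [NormedSpace ℝ E] {t : ℝ≥0} {f : ℝ≥0 → E}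
    (hf : AEStronglyMeasurable f (lebesgue.restrict (Set.Icc 0 t))) (p q : StepFunction E t) :
    eLpNorm (fun s ↦ p.eval s - q.eval s) 2 (lebesgue.restrict (Set.Icc 0 t)) ≤
      eLpNorm (fun s ↦ f s - p.eval s) 2 (lebesgue.restrict (Set.Icc 0 t)) +
        eLpNorm (fun s ↦ f s - q.eval s) 2 (lebesgue.restrict (Set.Icc 0 t)) := by
  have h : (fun s ↦ p.eval s - q.eval s) =
      (fun s ↦ f s - q.eval s) - fun s ↦ f s - p.eval s := by
    ext s
    simp
  rw [h, add_comm]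
  exact eLpNorm_sub_le (hf.sub q.memLp_eval.1) (hf.sub p.memLp_eval.1) (by norm_num)

end StepFunction

variable [InnerProductSpace ℝ E]

/-- By the isometry the elementary integrals are Cauchy. The limit is taken in `L²` of `P` trimmed
to `𝓕 t`, so it has an `𝓕 t`-measurable representative without completing the filtration. The
approximants are kept on partitions for the later cumulant computation. -/
theorem IsLevyProcess.exists_stochasticIntegral [IsProbabilityMeasure P] [CompleteSpace E]
    (hU : IsLevyProcess 𝓕 P U) (hvar : ∀ t, MemLp (U t) 2 P) (hmean : ∀ t, ∫ ω, U t ω ∂P = 0)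
    {t : ℝ≥0} {f : ℝ≥0 → E} (hf : MemLp f 2 (lebesgue.restrict (Set.Icc 0 t))) :
    ∃ Y : Ω → E, StronglyMeasurable[𝓕 t] Y ∧ MemLp Y 2 P ∧ ∃ p : ℕ → StepFunction E t,
      (∀ n, ∃ (τ : ℕ → ℝ≥0) (hτ : Monotone τ) (m : ℕ) (hm : τ m ≤ t) (v : ℕ → E),
        p n = StepFunction.ofPartition τ hτ m hm v) ∧
      Tendsto (fun n ↦ eLpNorm (fun s ↦ f s - (p n).eval s) 2 (lebesgue.restrict (Set.Icc 0 t)))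
        atTop (𝓝 0) ∧
      Tendsto (fun n ↦ eLpNorm (fun ω ↦ Y ω - (p n).integral U ω) 2 P) atTop (𝓝 0) := by
  have h2 : ∀ n : ℕ, ((2 : ℝ≥0∞)⁻¹ ^ n) ≠ 0 := fun n ↦ by simp
  choose τ hτ m hm v hv using fun n ↦ StepFunction.exists_ofPartition_eLpNorm_sub_le hf (h2 n)
  set p : ℕ → StepFunction E t := fun n ↦ StepFunction.ofPartition (τ n) (hτ n) (m n) (hm n) (v n)
  set C := ENNReal.ofReal (√(∫ ω, U 1 ω ^ 2 ∂P)) with hC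
  -- The isometry gives `C * 2 * 2⁻¹ ^ N`; the extra `1` makes the inequality strict, also when `C =
  -- 0`.
  have hcau : ∀ N n m : ℕ, N ≤ n → N ≤ m →
      eLpNorm ((p n).integral U - (p m).integral U) 2 (P.trim (𝓕.le t)) <
        (C * 2 + 1) * 2⁻¹ ^ N := by
    intro N n m hn hm
    have hpow : ∀ {n}, N ≤ n → (2 : ℝ≥0∞)⁻¹ ^ n ≤ 2⁻¹ ^ N := fun h ↦
      pow_le_pow_right_of_le_one' (by simp) h
    rw [eLpNorm_trim (𝓕.le t) (((p n).stronglyMeasurable_integral hU).sub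
      ((p m).stronglyMeasurable_integral hU))]
    have h1 := hU.eLpNorm_integral_sub_integral hvar hmean (p n) (p m)
    have h3 := (p n).eLpNorm_eval_sub_eval_le hf.1 (p m)
    calc eLpNorm ((p n).integral U - (p m).integral U) 2 P
        ≤ C * (2⁻¹ ^ N + 2⁻¹ ^ N) := by
          refine h1.le.trans ?_
          gcongr
          exact h3.trans (add_le_add ((hv n).trans (hpow hn)) ((hv m).trans (hpow hm)))
      _ = C * 2 * 2⁻¹ ^ N := by rw [← two_mul, mul_assoc]
      _ < (C * 2 + 1) * 2⁻¹ ^ N := by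
          refine (ENNReal.mul_lt_mul_iff_left (h2 N) (by simp)).2 ?_
          exact ENNReal.lt_add_right (by simp [hC, ENNReal.mul_eq_top]) one_ne_zero
  have hB : ∑' N : ℕ, (C * 2 + 1) * (2 : ℝ≥0∞)⁻¹ ^ N ≠ ∞ := by
    rw [ENNReal.tsum_mul_left, ENNReal.tsum_geometric]
    simp [hC, ENNReal.mul_eq_top]
  have hmem : ∀ n, MemLp ((p n).integral U) 2 (P.trim (𝓕.le t)) := fun n ↦
    ⟨((p n).stronglyMeasurable_integral hU).aestronglyMeasurable, by
      rw [eLpNorm_trim (𝓕.le t) ((p n).stronglyMeasurable_integral hU)]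
      exact ((p n).memLp_integral hvar).2⟩
  obtain ⟨Y₀, hY₀, hlim⟩ := Lp.cauchy_complete_eLpNorm (by norm_num) hmem hB hcau
  have hsm : StronglyMeasurable[𝓕 t] (hY₀.1.mk Y₀) := hY₀.1.stronglyMeasurable_mk
  have hmk : MemLp (hY₀.1.mk Y₀) 2 (P.trim (𝓕.le t)) := (memLp_congr_ae hY₀.1.ae_eq_mk).1 hY₀
  refine ⟨hY₀.1.mk Y₀, hsm, memLp_of_memLp_trim _ hmk, p, fun n ↦ ⟨_, _, _, _, _, rfl⟩, ?_, ?_⟩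
  · refine tendsto_of_tendsto_of_tendsto_of_le_of_le tendsto_const_nhds
      (ENNReal.tendsto_pow_atTop_nhds_zero_of_lt_one (r := 2⁻¹) ?_) (fun _ ↦ zero_le) hv
    simp
  · refine hlim.congr fun n ↦ ?_
    have h4 : (p n).integral U - Y₀ =ᵐ[P.trim (𝓕.le t)] (p n).integral U - hY₀.1.mk Y₀ :=
      (EventuallyEq.refl _ _).sub hY₀.1.ae_eq_mk
    rw [eLpNorm_congr_ae h4, eLpNorm_trim (𝓕.le t)
      (((p n).stronglyMeasurable_integral hU).sub hsm), eLpNorm_sub_comm]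
    rfl

/-- The stochastic integral is unique up to almost sure equality. -/
theorem IsLevyProcess.ae_eq_of_isStochasticIntegral [IsProbabilityMeasure P]
    (hU : IsLevyProcess 𝓕 P U) (hvar : ∀ t, MemLp (U t) 2 P) (hmean : ∀ t, ∫ ω, U t ω ∂P = 0)
    {t : ℝ≥0} {f : ℝ≥0 → E}
    (hf : AEStronglyMeasurable f (lebesgue.restrict (Set.Icc 0 t))) {Y Y' : Ω → E}
    (hY : IsStochasticIntegral P U t f Y) (hY' : IsStochasticIntegral P U t f Y') :
    Y =ᵐ[P] Y' := by
  obtain ⟨hYm, p, hp, hpY⟩ := hY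
  obtain ⟨hYm', q, hq, hqY⟩ := hY'
  set C := ENNReal.ofReal (√(∫ ω, U 1 ω ^ 2 ∂P)) with hC
  have hle : ∀ n, eLpNorm (Y - Y') 2 P ≤
      eLpNorm (fun ω ↦ Y ω - (p n).integral U ω) 2 P +
        (C * (eLpNorm (fun s ↦ f s - (p n).eval s) 2 (lebesgue.restrict (Set.Icc 0 t)) +
        eLpNorm (fun s ↦ f s - (q n).eval s) 2 (lebesgue.restrict (Set.Icc 0 t))) +
        eLpNorm (fun ω ↦ Y' ω - (q n).integral U ω) 2 P) := by
    intro n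
    -- Of the three differences, the outer two tend to zero by assumption and the middle one by the
    -- isometry.
    have h : Y - Y' = (fun ω ↦ Y ω - (p n).integral U ω) +
        ((fun ω ↦ (p n).integral U ω - (q n).integral U ω) -
          fun ω ↦ Y' ω - (q n).integral U ω) := by
      ext ω
      simp
    have hpm := ((p n).memLp_integral hvar).1
    have hqm := ((q n).memLp_integral hvar).1
    rw [h]
    refine (eLpNorm_add_le (p := 2) (hYm.1.sub hpm) ((hpm.sub hqm).sub (hYm'.1.sub hqm))
      (by norm_num)).trans (add_le_add le_rfl ?_)
    refine (eLpNorm_sub_le (p := 2) (hpm.sub hqm) (hYm'.1.sub hqm) (by norm_num)).trans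
      (add_le_add ?_ le_rfl)
    refine (hU.eLpNorm_integral_sub_integral hvar hmean (p n) (q n)).le.trans ?_
    gcongr
    exact (p n).eLpNorm_eval_sub_eval_le hf (q n)
  have hlim := hpY.add ((ENNReal.Tendsto.const_mul (a := C) (hp.add hq)
    (Or.inr (by simp [hC]))).add hqY)
  simp only [add_zero, mul_zero] at hlim
  have h0 : eLpNorm (Y - Y') 2 P = 0 := le_antisymm (ge_of_tendsto' hlim hle) zero_le
  rw [eLpNorm_eq_zero_iff (hYm.1.sub hYm'.1) two_ne_zero] at h0
  filter_upwards [h0] with ω hω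
  exact sub_eq_zero.1 hω

theorem ContinuousLinearMap.tendsto_eLpNorm_comp_zero {E F : Type*}
    [NormedAddCommGroup E] [NormedSpace ℝ E] [NormedAddCommGroup F] [NormedSpace ℝ F]
    (L : E →L[ℝ] F) {α : Type*} {m : MeasurableSpace α} {μ : Measure α} {p : ℝ≥0∞}
    {x : ℕ → α → E} (hx : Tendsto (fun n ↦ eLpNorm (x n) p μ) atTop (𝓝 0)) :
    Tendsto (fun n ↦ eLpNorm (fun a ↦ L (x n a)) p μ) atTop (𝓝 0) := by
  have h := ENNReal.Tendsto.const_mul (a := ENNReal.ofReal ‖L‖) hx (Or.inr (by simp))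
  rw [mul_zero] at h
  exact tendsto_of_tendsto_of_tendsto_of_le_of_le tendsto_const_nhds h (fun _ ↦ zero_le)
    fun n ↦ eLpNorm_le_mul_eLpNorm_of_ae_le_mul (ae_of_all _ fun a ↦ L.le_opNorm _) p

/-- Bounded operators commute with the stochastic integral. -/
theorem IsStochasticIntegral.map {F : Type*} [NormedAddCommGroup F] [NormedSpace ℝ F]
    {t : ℝ≥0} {f : ℝ≥0 → E} {Y : Ω → E} (hY : IsStochasticIntegral P U t f Y) (L : E →L[ℝ] F) :
    IsStochasticIntegral P U t (fun s ↦ L (f s)) (fun ω ↦ L (Y ω)) := by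
  obtain ⟨hYm, p, hp, hpY⟩ := hY
  refine ⟨L.comp_memLp' hYm, fun n ↦ ⟨(p n).n, (p n).a, (p n).b, fun i ↦ L ((p n).v i),
    (p n).a_le_b, (p n).b_le⟩, ?_, ?_⟩
  · refine (L.tendsto_eLpNorm_comp_zero hp).congr fun n ↦ congrArg (eLpNorm · 2 _) (funext fun s ↦ ?_)
    rw [map_sub]
    congr 1
    rw [StepFunction.eval, StepFunction.eval, map_sum]
    refine Finset.sum_congr rfl fun i _ ↦ ?_
    by_cases h : s ∈ Set.Ioc ((p n).a i) ((p n).b i) <;> simp [h]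
  · refine (L.tendsto_eLpNorm_comp_zero hpY).congr fun n ↦ congrArg (eLpNorm · 2 _) (funext fun ω ↦ ?_)
    rw [map_sub]
    congr 1
    rw [StepFunction.integral, StepFunction.integral, map_sum]
    exact Finset.sum_congr rfl fun i _ ↦ map_smul _ _ _

end

/-! ### The characteristic function of the stochastic integral. -/

section

variable {Ω : Type*} {mΩ : MeasurableSpace Ω} {P : Measure Ω}
  {𝓕 : Filtration ℝ≥0 mΩ} {U : ℝ≥0 → Ω → ℝ} {E : Type*} [NormedAddCommGroup E]

/-- Partition cells are disjoint, so at most one term is active at each point and even a nonlinear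
`F` acts on the values separately. For overlapping intervals this fails. -/
theorem StepFunction.apply_eval_ofPartition {E' : Type*} [NormedAddCommGroup E'] {t : ℝ≥0}
    (F : E → E') (hF : F 0 = 0)
    {τ : ℕ → ℝ≥0} (hτ : Monotone τ) {n : ℕ} (hn : τ n ≤ t) (v : ℕ → E) (s : ℝ≥0) :
    F ((ofPartition τ hτ n hn v).eval s) = (ofPartition τ hτ n hn fun i ↦ F (v i)).eval s := by
  by_cases h : ∃ i < n, s ∈ Set.Ioc (τ i) (τ (i + 1))
  · obtain ⟨i, hi, hs⟩ := h
    rw [eval_ofPartition_of_mem hτ hn _ hi hs, eval_ofPartition_of_mem hτ hn _ hi hs]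
  · push Not at h
    have h1 : (ofPartition τ hτ n hn v).eval s = 0 :=
      Finset.sum_eq_zero fun (i : Fin n) _ ↦ Set.indicator_of_notMem (h i i.2) _
    rw [h1, hF]
    exact (Finset.sum_eq_zero fun (i : Fin n) _ ↦ Set.indicator_of_notMem (h i i.2) _).symm

theorem StepFunction.integral_eval_ofPartition [NormedSpace ℝ E] [CompleteSpace E] {t : ℝ≥0}
    {τ : ℕ → ℝ≥0} (hτ : Monotone τ) {n : ℕ} (hn : τ n ≤ t) (v : ℕ → E) :
    ∫ s in Set.Icc 0 t, (ofPartition τ hτ n hn v).eval s ∂lebesgue =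
      ∑ i ∈ Finset.range n, ((τ (i + 1) - τ i : ℝ≥0) : ℝ) • v i := by
  have h : ∀ i : Fin n, ∫ s in Set.Icc 0 t, (Set.Ioc (τ i) (τ (i + 1))).indicator
      (fun _ ↦ v i) s ∂lebesgue = ((τ (i + 1) - τ i : ℝ≥0) : ℝ) • v i := fun i ↦ by
    rw [integral_indicator measurableSet_Ioc, Measure.restrict_restrict measurableSet_Ioc,
      Set.inter_eq_left.2, setIntegral_const, measureReal_def, lebesgue_Ioc]
    · congr 1
    · exact fun s hs ↦ ⟨zero_le, hs.2.trans ((hτ i.2).trans hn)⟩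
  rw [Finset.sum_range]
  refine (integral_finsetSum (Finset.univ : Finset (Fin n))
    (f := fun i ↦ (Set.Ioc (τ i) (τ (i + 1))).indicator (fun _ ↦ v i))
    fun i _ ↦ integrable_indicator_Ioc t _ _ _).trans ?_
  exact Finset.sum_congr rfl fun i _ ↦ h i

theorem continuous_of_norm_sub_le_mul {F : E → ℂ} {K : ℝ}
    (hF : ∀ x y, ‖F x - F y‖ ≤ K * (‖x - y‖ * (‖x‖ + ‖y‖))) : Continuous F := by
  refine continuous_iff_continuousAt.2 fun y ↦ tendsto_iff_norm_sub_tendsto_zero.2 ?_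
  have h : Tendsto (fun x ↦ K * (‖x - y‖ * (‖x‖ + ‖y‖))) (𝓝 y) (𝓝 (K * (‖y - y‖ * (‖y‖ + ‖y‖)))) :=
    (by fun_prop : Continuous fun x ↦ K * (‖x - y‖ * (‖x‖ + ‖y‖))).continuousAt
  rw [sub_self, norm_zero, zero_mul, mul_zero] at h
  exact squeeze_zero (fun _ ↦ norm_nonneg _) (fun x ↦ hF x y) h

variable [InnerProductSpace ℝ E] {ψ : ℝ → ℂ} {K : ℝ}

theorem norm_comp_inner_sub_le (hK : 0 ≤ K)
    (hψ : ∀ u v, ‖ψ u - ψ v‖ ≤ K * (|u - v| * (|u| + |v|))) (η x y : E) :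
    ‖ψ (inner ℝ η x) - ψ (inner ℝ η y)‖ ≤ K * ‖η‖ ^ 2 * (‖x - y‖ * (‖x‖ + ‖y‖)) := by
  refine (hψ _ _).trans ?_
  rw [← inner_sub_right]
  calc K * (|inner ℝ η (x - y)| * (|inner ℝ η x| + |inner ℝ η y|))
      ≤ K * (‖η‖ * ‖x - y‖ * (‖η‖ * ‖x‖ + ‖η‖ * ‖y‖)) := by
        gcongr <;> exact abs_real_inner_le_norm _ _
    _ = _ := by ring

theorem norm_comp_inner_sub_le' (hK : 0 ≤ K)
    (hψ : ∀ u v, ‖ψ u - ψ v‖ ≤ K * (|u - v| * (|u| + |v|))) (η η' x : E) :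
    ‖ψ (inner ℝ η x) - ψ (inner ℝ η' x)‖ ≤
      K * (‖η - η'‖ * (‖η‖ + ‖η'‖)) * ‖x‖ ^ 2 := by
  rw [real_inner_comm, real_inner_comm x η']
  refine (norm_comp_inner_sub_le hK hψ x η η').trans (le_of_eq ?_)
  ring

theorem aestronglyMeasurable_comp_inner (hψc : Continuous ψ) {α : Type*} {m : MeasurableSpace α}
    {μ : Measure α} {f : α → E} (hf : AEStronglyMeasurable f μ) (η : E) :
    AEStronglyMeasurable (fun s ↦ ψ (inner ℝ η (f s))) μ :=
  (by fun_prop : Continuous fun x : E ↦ ψ (inner ℝ η x)).comp_aestronglyMeasurable hf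

/-- Comparison with the value at `0` gives quadratic growth, which square integrability of `f`
absorbs. -/
theorem integrable_comp_inner (hK : 0 ≤ K) (hψ0 : ψ 0 = 0)
    (hψ : ∀ u v, ‖ψ u - ψ v‖ ≤ K * (|u - v| * (|u| + |v|))) {α : Type*} {m : MeasurableSpace α}
    {μ : Measure α} {f : α → E} (hf : MemLp f 2 μ) (η : E) :
    Integrable (fun s ↦ ψ (inner ℝ η (f s))) μ := by
  refine (hf.norm.integrable_sq.const_mul (K * ‖η‖ ^ 2)).mono'
    (aestronglyMeasurable_comp_inner (continuous_of_norm_sub_le_mul hψ) hf.1 η)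
    (ae_of_all _ fun s ↦ ?_)
  have h := norm_comp_inner_sub_le hK hψ η (f s) 0
  simp only [inner_zero_right, hψ0, sub_zero, norm_zero, add_zero] at h
  rwa [sq ‖f s‖]

theorem continuous_integral_comp_inner (hK : 0 ≤ K) (hψ0 : ψ 0 = 0)
    (hψ : ∀ u v, ‖ψ u - ψ v‖ ≤ K * (|u - v| * (|u| + |v|))) {α : Type*} {m : MeasurableSpace α}
    {μ : Measure α} {f : α → E} (hf : MemLp f 2 μ) :
    Continuous fun η ↦ ∫ s, ψ (inner ℝ η (f s)) ∂μ := by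
  refine continuous_of_norm_sub_le_mul (K := K * ∫ s, ‖f s‖ ^ 2 ∂μ) fun η η' ↦ ?_
  rw [← integral_sub (integrable_comp_inner hK hψ0 hψ hf η)
    (integrable_comp_inner hK hψ0 hψ hf η')]
  refine (norm_integral_le_of_norm_le (hf.norm.integrable_sq.const_mul _)
    (ae_of_all _ fun s ↦ norm_comp_inner_sub_le' hK hψ η η' (f s))).trans (le_of_eq ?_)
  rw [integral_const_mul]
  ring

/-- `f ↦ ∫ ψ(⟨η, f⟩)` is continuous on `L²`. -/
theorem tendsto_integral_comp_inner (hK : 0 ≤ K) (hψ0 : ψ 0 = 0)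
    (hψ : ∀ u v, ‖ψ u - ψ v‖ ≤ K * (|u - v| * (|u| + |v|))) {α : Type*} {m : MeasurableSpace α}
    {μ : Measure α} {f : α → E} (hf : MemLp f 2 μ) {p : ℕ → α → E} (hp : ∀ n, MemLp (p n) 2 μ)
    (hlim : Tendsto (fun n ↦ eLpNorm (fun s ↦ f s - p n s) 2 μ) atTop (𝓝 0)) (η : E) :
    Tendsto (fun n ↦ ∫ s, ψ (inner ℝ η (p n s)) ∂μ) atTop
      (𝓝 (∫ s, ψ (inner ℝ η (f s)) ∂μ)) := by
  refine tendsto_integral_of_L1' _ (integrable_comp_inner hK hψ0 hψ hf η).aestronglyMeasurable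
    (Eventually.of_forall fun n ↦ integrable_comp_inner hK hψ0 hψ (hp n) η) ?_
  set D : ℕ → ℝ≥0∞ := fun n ↦ eLpNorm (fun s ↦ f s - p n s) 2 μ
  have hψc := continuous_of_norm_sub_le_mul hψ
  have hbd : ∀ n, eLpNorm ((fun s ↦ ψ (inner ℝ η (p n s))) - fun s ↦ ψ (inner ℝ η (f s))) 1 μ ≤
      ENNReal.ofReal (K * ‖η‖ ^ 2) * (D n * (D n + (eLpNorm f 2 μ + eLpNorm f 2 μ))) := by
    intro n
    have hpf : eLpNorm (fun s ↦ ‖p n s‖ + ‖f s‖) 2 μ ≤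
        D n + (eLpNorm f 2 μ + eLpNorm f 2 μ) := by
      refine (eLpNorm_add_le (hp n).1.norm hf.1.norm (by norm_num)).trans ?_
      rw [eLpNorm_norm, eLpNorm_norm, ← add_assoc]
      gcongr
      have : p n = f - fun s ↦ f s - p n s := by
        ext s
        simp
      nth_rw 1 [this]
      rw [add_comm]
      exact eLpNorm_sub_le hf.1 (hf.1.sub (hp n).1) (by norm_num)
    -- Cauchy–Schwarz: the first factor tends to zero while the second stays bounded.
    have hmul : eLpNorm (fun s ↦ ‖p n s - f s‖ * (‖p n s‖ + ‖f s‖)) 1 μ ≤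
        D n * eLpNorm (fun s ↦ ‖p n s‖ + ‖f s‖) 2 μ := by
      have h := eLpNorm_smul_le_mul_eLpNorm (p := 2) (q := 2) (r := 1)
        ((hp n).1.norm.add hf.1.norm) ((hp n).1.sub hf.1).norm
      rw [eLpNorm_norm, eLpNorm_sub_comm] at h
      exact h
    refine (eLpNorm_le_mul_eLpNorm_of_ae_le_mul (c := K * ‖η‖ ^ 2)
      (g := fun s ↦ ‖p n s - f s‖ * (‖p n s‖ + ‖f s‖)) (ae_of_all _ fun s ↦ ?_) 1).trans ?_
    · rw [Real.norm_of_nonneg (by positivity)]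
      exact norm_comp_inner_sub_le hK hψ η (p n s) (f s)
    · gcongr
      exact hmul.trans (by gcongr)
  have hN : eLpNorm f 2 μ + eLpNorm f 2 μ ≠ ∞ := by simp [hf.2.ne]
  have h1 : Tendsto (fun n ↦ D n + (eLpNorm f 2 μ + eLpNorm f 2 μ)) atTop
      (𝓝 (0 + (eLpNorm f 2 μ + eLpNorm f 2 μ))) := hlim.add tendsto_const_nhds
  rw [zero_add] at h1
  have h2 := ENNReal.Tendsto.const_mul (a := ENNReal.ofReal (K * ‖η‖ ^ 2))
    (ENNReal.Tendsto.mul hlim (Or.inr hN) h1 (Or.inr (by simp))) (Or.inr (by simp))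
  rw [zero_mul, mul_zero] at h2
  exact tendsto_of_tendsto_of_tendsto_of_le_of_le tendsto_const_nhds h2 (fun _ ↦ zero_le) hbd

/-- The characteristic function is continuous under convergence in `L²`. -/
theorem tendsto_integral_exp_inner [IsProbabilityMeasure P] {Y : Ω → E} (hY : MemLp Y 2 P)
    {I : ℕ → Ω → E} (hI : ∀ n, MemLp (I n) 2 P)
    (hlim : Tendsto (fun n ↦ eLpNorm (fun ω ↦ Y ω - I n ω) 2 P) atTop (𝓝 0)) (η : E) :
    Tendsto (fun n ↦ ∫ ω, Complex.exp (Complex.I * (inner ℝ η (I n ω) : ℝ)) ∂P) atTop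
      (𝓝 (∫ ω, Complex.exp (Complex.I * (inner ℝ η (Y ω) : ℝ)) ∂P)) := by
  have hm : ∀ {Z : Ω → E}, MemLp Z 2 P →
      Integrable (fun ω ↦ Complex.exp (Complex.I * (inner ℝ η (Z ω) : ℝ))) P := fun hZ ↦
    IsLevyProcess.integrable_exp_I_mul (hZ.1.const_inner)
  refine tendsto_integral_of_L1' _ (hm hY).aestronglyMeasurable
    (Eventually.of_forall fun n ↦ hm (hI n)) ?_
  have h2 := ENNReal.Tendsto.const_mul (a := ENNReal.ofReal ‖η‖) hlim (Or.inr (by simp))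
  rw [mul_zero] at h2
  refine tendsto_of_tendsto_of_tendsto_of_le_of_le tendsto_const_nhds h2 (fun _ ↦ zero_le)
    fun n ↦ ?_
  have h3 : eLpNorm (fun ω ↦ Y ω - I n ω) 1 P ≤ eLpNorm (fun ω ↦ Y ω - I n ω) 2 P :=
    eLpNorm_le_eLpNorm_of_exponent_le (by norm_num) (hY.1.sub (hI n).1)
  refine (eLpNorm_le_mul_eLpNorm_of_ae_le_mul (c := ‖η‖)
    (g := fun ω ↦ Y ω - I n ω) (ae_of_all _ fun ω ↦ ?_) 1).trans (by gcongr)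
  refine (norm_exp_I_mul_sub_exp_I_mul_le _ _).trans ?_
  rw [← inner_sub_right, norm_sub_rev]
  exact abs_real_inner_le_norm _ _

theorem IsLevyProcess.integral_exp_inner_ofPartition [IsProbabilityMeasure P]
    (hU : IsLevyProcess 𝓕 P U) (hψ0 : ψ 0 = 0) (hψU : ∀ (t : ℝ≥0) (u : ℝ),
        ∫ ω, Complex.exp (Complex.I * (u * U t ω : ℝ)) ∂P = Complex.exp (t * ψ u))
    {t : ℝ≥0} {τ : ℕ → ℝ≥0} (hτ : Monotone τ) {n : ℕ} (hn : τ n ≤ t) (v : ℕ → E) (η : E) :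
    ∫ ω, Complex.exp (Complex.I *
      (inner ℝ η ((StepFunction.ofPartition τ hτ n hn v).integral U ω) : ℝ)) ∂P =
      Complex.exp (∫ s in Set.Icc 0 t,
        ψ (inner ℝ η ((StepFunction.ofPartition τ hτ n hn v).eval s)) ∂lebesgue) := by
  have h1 : ∀ ω, inner ℝ η ((StepFunction.ofPartition τ hτ n hn v).integral U ω) =
      ∑ i ∈ Finset.range n, inner ℝ η (v i) * (U (τ (i + 1)) ω - U (τ i) ω) := fun ω ↦ by
    rw [Finset.sum_range]
    refine (inner_sum _ _ _).trans (Finset.sum_congr rfl fun i _ ↦ ?_)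
    rw [real_inner_smul_right, mul_comm]
    rfl
  simp_rw [h1, hU.integral_exp_sum_increment hψU hτ,
    StepFunction.apply_eval_ofPartition (fun x : E ↦ ψ (inner ℝ η x)) (by simp [hψ0]) hτ hn v]
  rw [StepFunction.integral_eval_ofPartition]
  simp

/-- The characteristic function of the stochastic integral of a deterministic integrand. -/
theorem IsLevyProcess.integral_exp_inner_stochasticIntegral [IsProbabilityMeasure P]
    [CompleteSpace E] (hU : IsLevyProcess 𝓕 P U) (hvar : ∀ t, MemLp (U t) 2 P)
    (hmean : ∀ t, ∫ ω, U t ω ∂P = 0) (hK : 0 ≤ K) (hψ0 : ψ 0 = 0)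
    (hψ : ∀ u v, ‖ψ u - ψ v‖ ≤ K * (|u - v| * (|u| + |v|)))
    (hψU : ∀ (t : ℝ≥0) (u : ℝ),
        ∫ ω, Complex.exp (Complex.I * (u * U t ω : ℝ)) ∂P = Complex.exp (t * ψ u))
    {t : ℝ≥0} {f : ℝ≥0 → E} (hf : MemLp f 2 (lebesgue.restrict (Set.Icc 0 t))) {Y : Ω → E}
    (hY : IsStochasticIntegral P U t f Y) (η : E) :
    ∫ ω, Complex.exp (Complex.I * (inner ℝ η (Y ω) : ℝ)) ∂P =
      Complex.exp (∫ s in Set.Icc 0 t, ψ (inner ℝ η (f s)) ∂lebesgue) := by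
  -- The step functions behind `Y` may have overlapping intervals; uniqueness allows replacing `Y`
  -- by an integral approximated on partitions.
  obtain ⟨Y', -, hY'm, p, hpart, hpf, hpY⟩ := hU.exists_stochasticIntegral hvar hmean hf
  have hae := hU.ae_eq_of_isStochasticIntegral hvar hmean hf.1 hY ⟨hY'm, p, hpf, hpY⟩
  have h1 : ∫ ω, Complex.exp (Complex.I * (inner ℝ η (Y ω) : ℝ)) ∂P =
      ∫ ω, Complex.exp (Complex.I * (inner ℝ η (Y' ω) : ℝ)) ∂P := by
    refine integral_congr_ae ?_
    filter_upwards [hae] with ω hω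
    rw [hω]
  rw [h1]
  refine tendsto_nhds_unique
    (tendsto_integral_exp_inner hY'm (fun n ↦ (p n).memLp_integral hvar) hpY η) ?_
  refine ((Complex.continuous_exp.tendsto _).comp (tendsto_integral_comp_inner hK hψ0 hψ hf
    (fun n ↦ (p n).memLp_eval) hpf η)).congr fun n ↦ ?_
  obtain ⟨τ, hτ, m, hm, v, hp⟩ := hpart n
  simp only [Function.comp_apply, hp]
  exact (hU.integral_exp_inner_ofPartition hψ0 hψU hτ hm v η).symm

end

/-! ### The factor process. -/

section

variable {E : Type*} [NormedAddCommGroup E]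

theorem memLp_two_restrict_Icc {k : ℝ≥0 → E} (hk : AEStronglyMeasurable k lebesgue) {t : ℝ≥0}
    (hk2 : ∫⁻ s in Set.Icc 0 t, ‖k s‖ₑ ^ 2 ∂lebesgue < ∞) :
    MemLp k 2 (lebesgue.restrict (Set.Icc 0 t)) := by
  refine ⟨hk.restrict, (eLpNorm_lt_top_iff_lintegral_rpow_enorm_lt_top two_ne_zero
    ENNReal.ofNat_ne_top).2 ?_⟩
  simpa using hk2

theorem IsStochasticIntegral.congr {Ω : Type*} {mΩ : MeasurableSpace Ω} {P : Measure Ω}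
    [NormedSpace ℝ E] {U : ℝ≥0 → Ω → ℝ} {t : ℝ≥0} {f f' : ℝ≥0 → E} {Y Y' : Ω → E}
    (h : IsStochasticIntegral P U t f Y) (hf : f = f') (hY : Y = Y') :
    IsStochasticIntegral P U t f' Y' := hf ▸ hY ▸ h

end

theorem lemma4p6 {Ω : Type*} {mΩ : MeasurableSpace Ω} (P : Measure Ω) [IsProbabilityMeasure P]
    (𝓕 : Filtration ℝ≥0 mΩ)
    {H : Type*} [NormedAddCommGroup H] [InnerProductSpace ℝ H] [CompleteSpace H]
    (V : HilbertFunctionSpace H)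
    (S : ℝ≥0 → H →L[ℝ] H) (hS : V.IsBoundedShift S)
    (U : ℝ≥0 → Ω → ℝ) (hU : IsLevyProcess 𝓕 P U)
    (hU_var : ∀ t, MemLp (U t) 2 P) (hU_mean : ∀ t, ∫ ω, U t ω ∂P = 0)
    (h : ℝ≥0 → V.carrier) (g : V.carrier)
    (hg_meas : AEStronglyMeasurable (fun s ↦ S s (V.toH g)) lebesgue)
    (hg : ∀ t : ℝ≥0, ∫⁻ s in Set.Icc 0 t, ‖S s (V.toH g)‖ₑ ^ 2 ∂lebesgue < ∞) :
    -- `X` exists as an adapted `H`-valued process,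
    (∃ X : ℝ≥0 → Ω → H, IsFactorProcess P U S (fun t ↦ V.toH (h t)) (V.toH g) X ∧
      StronglyAdapted 𝓕 X) ∧
    -- it is well defined up to modification,
    (∀ X X' : ℝ≥0 → Ω → H, IsFactorProcess P U S (fun t ↦ V.toH (h t)) (V.toH g) X →
      IsFactorProcess P U S (fun t ↦ V.toH (h t)) (V.toH g) X' → ∀ t, X t =ᵐ[P] X' t) ∧
    -- it is given by the scalar stochastic integrals at each point with a continuous evaluation,
    (∀ X : ℝ≥0 → Ω → H, IsFactorProcess P U S (fun t ↦ V.toH (h t)) (V.toH g) X →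
      ∀ (x : ℝ≥0) (δ : H →L[ℝ] ℝ), V.IsEvaluation x δ → ∀ t : ℝ≥0,
        IsStochasticIntegral P U t (fun s ↦ (g : ℝ≥0 → ℝ) (t - s + x))
          (fun ω ↦ δ (X t ω) - (h t : ℝ≥0 → ℝ) x)) ∧
    -- and its cumulant is given in terms of the cumulant of `U(1)`.
    ∃ ψ : ℝ → ℂ, IsCumulant P (U 1) ψ ∧
      (∀ (t : ℝ≥0) (η : H),
        IntegrableOn (fun s : ℝ≥0 ↦ ψ (inner ℝ η (S s (V.toH g)))) (Set.Icc 0 t) lebesgue) ∧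
      ∀ X : ℝ≥0 → Ω → H, IsFactorProcess P U S (fun t ↦ V.toH (h t)) (V.toH g) X →
        ∀ t : ℝ≥0, IsCumulant P (X t) (fun η ↦
          Complex.I * (inner ℝ η (V.toH (h t)) : ℂ) +
            ∫ s in Set.Icc 0 t, ψ (inner ℝ η (S s (V.toH g))) ∂lebesgue) := by
  have hk : ∀ t : ℝ≥0, MemLp (fun s ↦ S s (V.toH g)) 2 (lebesgue.restrict (Set.Icc 0 t)) :=
    fun t ↦ memLp_two_restrict_Icc hg_meas (hg t)
  have hf : ∀ t : ℝ≥0, MemLp (fun s ↦ S (t - s) (V.toH g)) 2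
      (lebesgue.restrict (Set.Icc 0 t)) :=
    fun t ↦ (hk t).comp_measurePreserving (measurePreserving_tsub_lebesgue t)
  refine ⟨?_, fun X X' hX hX' t ↦ ?_, fun X hX x δ hδ t ↦ ?_, ?_⟩
  · choose Y hYmeas hYm p _ hpf hpY using fun t ↦
      hU.exists_stochasticIntegral hU_var hU_mean (hf t)
    refine ⟨fun t ω ↦ Y t ω + V.toH (h t), fun t ↦ ?_, fun t ↦
      (hYmeas t).add stronglyMeasurable_const⟩
    have hY : IsStochasticIntegral P U t (fun s ↦ S (t - s) (V.toH g)) (Y t) :=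
      ⟨hYm t, p t, hpf t, hpY t⟩
    exact hY.congr rfl (funext fun ω ↦ (add_sub_cancel_right _ _).symm)
  · filter_upwards [hU.ae_eq_of_isStochasticIntegral hU_var hU_mean (hf t).1 (hX t) (hX' t)]
      with ω hω
    exact sub_left_injective hω
  · refine ((hX t).map δ).congr (funext fun s ↦ ?_) (funext fun ω ↦ ?_)
    · obtain ⟨hm, hSg⟩ := hS (t - s) g
      rw [hSg, hδ]
    · rw [map_sub, hδ]
  · obtain ⟨ψ, K, hK, hψ0, hψ, hψU⟩ := hU.exists_exponent hU_var hU_mean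
    have hψc : Continuous ψ := continuous_of_norm_sub_le_mul hψ
    -- The Lévy exponent is itself the distinguished logarithm for `U 1`: it is continuous, vanishes
    -- at `0`, and the semigroup formula is read at time `1`.
    refine ⟨ψ, ⟨hψc, hψ0, fun u ↦ ?_⟩, fun t η ↦ integrable_comp_inner hK hψ0 hψ (hk t) η,
      fun X hX t ↦ ⟨?_, ?_, fun η ↦ ?_⟩⟩
    · have h1 := hψU 1 u
      rw [NNReal.coe_one, Complex.ofReal_one, one_mul] at h1
      rw [← h1]
      refine integral_congr_ae (ae_of_all _ fun ω ↦ ?_)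
      simp [mul_comm]
    · exact (by fun_prop : Continuous fun η : H ↦
        Complex.I * (inner ℝ η (V.toH (h t)) : ℂ)).add
          (continuous_integral_comp_inner hK hψ0 hψ (hk t))
    · simp [hψ0]
    · have h1 := hU.integral_exp_inner_stochasticIntegral hU_var hU_mean hK hψ0 hψ hψU (hf t)
        (hX t) η
      have h2 : ∫ s in Set.Icc 0 t, ψ (inner ℝ η (S (t - s) (V.toH g))) ∂lebesgue =
          ∫ s in Set.Icc 0 t, ψ (inner ℝ η (S s (V.toH g))) ∂lebesgue := by
        have hmp := measurePreserving_tsub_lebesgue t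
        have h3 := integral_map (μ := lebesgue.restrict (Set.Icc 0 t))
          (f := fun s ↦ ψ (inner ℝ η (S s (V.toH g)))) hmp.measurable.aemeasurable (by
            rw [hmp.map_eq]
            exact aestronglyMeasurable_comp_inner hψc (hk t).1 η)
        rw [hmp.map_eq] at h3
        exact h3.symm
      rw [Complex.exp_add, ← h2, ← h1, ← integral_const_mul]
      refine integral_congr_ae (ae_of_all _ fun ω ↦ ?_)
      simp only
      rw [← Complex.exp_add, inner_sub_right]
      push_cast
      ring_nf
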